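/- Let $\Sigma$ be a finite alphabet of fixed size $q$ and let $\alpha\ge 1$ be any constant. There are a randomized algorithm and constants $C,k$, all depending only on $q$ and $\alpha$, such that for all $n,d\ge 1$ and all points $p_1,\dots,p_n\in\Sigma^d$ (repetitions allowed) the following holds. Let $M$ be the cost of a minimum spanning tree of the points, i.e. the minimum, over all trees $T$ on the vertex set $\{1,\dots,n\}$, of $\sum_{\{i,j\}\in T}\mathrm{ham}(p_i,p_j)$, where $\mathrm{ham}(a,b)$ is the number of coordinates in which $a$ and $b$ differ. On input $p_1,\dots,p_n$ the algorithm always halts and outputs a minimum spanning tree of the points, and with probability at least $1-\frac1{(nd)^{\alpha}}$ its running time is at most $$C\,f\,(1+\lfloor\log_2 f\rfloor)^k,\qquad f=n(d+n+M),$$ that is, it runs in $\tilde O(n(d+n+M))$ time with high probability. Here an algorithm is a program for a random access machine that can toss fair coins, and running time is measured by the logarithmic cost criterion (each operation costs the total binary length of the numbers, register indices and addresses that it handles). -/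

import Mathlib

/-! ## Randomized random access machines

Structured programs for a random access machine with registers `R[0], R[1], …`, a memory
`M[0], M[1], …`, all holding natural numbers, and an instruction that tosses a fair coin.
Running time is measured by the logarithmic cost criterion: handling a number costs its length in
binary, for every register index, address, operand and result that occurs. -/

namespace RAM

/-- A machine state. `pos` is the number of coins tossed so far. -/
structure State where
  reg : ℕ → ℕ
  mem : ℕ → ℕ
  pos : ℕ

/-- Length of the binary representation of `x` (and `1` for `x = 0`). -/
def bitLen (x : ℕ) : ℕ := Nat.log 2 x + 1

/-- Expressions: constants, registers, indirect memory access, and arithmetic. -/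
inductive Expr where
  | lit (k : ℕ)
  | reg (i : ℕ)
  | load (a : Expr)
  | add (a b : Expr)
  | sub (a b : Expr)
  | mul (a b : Expr)
  | div (a b : Expr)

/-- Value of an expression; subtraction is truncated, division is integer division. -/
def Expr.eval (s : State) : Expr → ℕ
  | .lit k => k
  | .reg i => s.reg i
  | .load a => s.mem (a.eval s)
  | .add a b => a.eval s + b.eval s
  | .sub a b => a.eval s - b.eval s
  | .mul a b => a.eval s * b.eval s
  | .div a b => a.eval s / b.eval s

/-- Logarithmic cost of evaluating an expression. -/
def Expr.cost (s : State) : Expr → ℕ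
  | .lit k => bitLen k
  | .reg i => bitLen i + bitLen (s.reg i)
  | .load a => a.cost s + bitLen (s.mem (a.eval s))
  | .add a b => a.cost s + b.cost s + bitLen (a.eval s + b.eval s)
  | .sub a b => a.cost s + b.cost s + bitLen (a.eval s - b.eval s)
  | .mul a b => a.cost s + b.cost s + bitLen (a.eval s * b.eval s)
  | .div a b => a.cost s + b.cost s + bitLen (a.eval s / b.eval s)

/-- Programs. -/
inductive Prog where
  | skip
  /-- `R[i] := e` -/
  | assign (i : ℕ) (e : Expr)
  /-- `M[a] := e` -/
  | store (a e : Expr)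
  /-- `R[i] := ` outcome (`0` or `1`) of a fair coin toss -/
  | toss (i : ℕ)
  | seq (c₁ c₂ : Prog)
  /-- if `e ≠ 0` then `c₁` else `c₂` -/
  | cond (e : Expr) (c₁ c₂ : Prog)
  /-- while `e ≠ 0` do `c` -/
  | loop (e : Expr) (c : Prog)

/-- `Runs ω c s s' t`: with the outcomes `ω 0, ω 1, …` of the coin tosses, the program `c` started
in the state `s` halts in the state `s'`, at total cost `t`. -/
inductive Runs (ω : ℕ → Bool) : Prog → State → State → ℕ → Prop where
  | skip (s : State) : Runs ω .skip s s 1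
  | assign (s : State) (i : ℕ) (e : Expr) :
      Runs ω (.assign i e) s { s with reg := Function.update s.reg i (e.eval s) }
        (bitLen i + e.cost s)
  | store (s : State) (a e : Expr) :
      Runs ω (.store a e) s { s with mem := Function.update s.mem (a.eval s) (e.eval s) }
        (a.cost s + e.cost s)
  | toss (s : State) (i : ℕ) :
      Runs ω (.toss i) s
        { s with reg := Function.update s.reg i (ω s.pos).toNat, pos := s.pos + 1 }
        (bitLen i + 1)
  | seq {c₁ c₂ : Prog} {s s' s'' : State} {t₁ t₂ : ℕ}
      (h₁ : Runs ω c₁ s s' t₁) (h₂ : Runs ω c₂ s' s'' t₂) :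
      Runs ω (.seq c₁ c₂) s s'' (t₁ + t₂)
  | cond_true {e : Expr} {c₁ c₂ : Prog} {s s' : State} {t : ℕ}
      (he : e.eval s ≠ 0) (h : Runs ω c₁ s s' t) :
      Runs ω (.cond e c₁ c₂) s s' (e.cost s + t)
  | cond_false {e : Expr} {c₁ c₂ : Prog} {s s' : State} {t : ℕ}
      (he : e.eval s = 0) (h : Runs ω c₂ s s' t) :
      Runs ω (.cond e c₁ c₂) s s' (e.cost s + t)
  | loop_stop {e : Expr} {c : Prog} {s : State} (he : e.eval s = 0) :
      Runs ω (.loop e c) s s (e.cost s)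
  | loop_step {e : Expr} {c : Prog} {s s' s'' : State} {t₁ t₂ : ℕ}
      (he : e.eval s ≠ 0) (h₁ : Runs ω c s s' t₁) (h₂ : Runs ω (.loop e c) s' s'' t₂) :
      Runs ω (.loop e c) s s'' (e.cost s + t₁ + t₂)

/-- The outcomes of the coin tosses determine the run: final state and cost are unique. -/
theorem Runs.unique {ω : ℕ → Bool} {c : Prog} {s s₁ s₂ : State} {t₁ t₂ : ℕ}
    (h₁ : Runs ω c s s₁ t₁) (h₂ : Runs ω c s s₂ t₂) : s₁ = s₂ ∧ t₁ = t₂ := by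
  induction h₁ generalizing s₂ t₂ with
  | skip | assign | store | toss => cases h₂; exact ⟨rfl, rfl⟩
  | seq _ _ ih₁ ih₂ =>
    cases h₂ with
    | seq k₁ k₂ =>
      obtain ⟨rfl, rfl⟩ := ih₁ k₁
      obtain ⟨rfl, rfl⟩ := ih₂ k₂
      exact ⟨rfl, rfl⟩
  | cond_true he _ ih =>
    cases h₂ with
    | cond_true _ k => obtain ⟨rfl, rfl⟩ := ih k; exact ⟨rfl, rfl⟩
    | cond_false he' _ => exact absurd he' he
  | cond_false he _ ih =>
    cases h₂ with
    | cond_true he' _ => exact absurd he he'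
    | cond_false _ k => obtain ⟨rfl, rfl⟩ := ih k; exact ⟨rfl, rfl⟩
  | loop_stop he =>
    cases h₂ with
    | loop_stop _ => exact ⟨rfl, rfl⟩
    | loop_step he' _ _ => exact absurd he he'
  | loop_step he _ _ ih₁ ih₂ =>
    cases h₂ with
    | loop_stop he' => exact absurd he' he
    | loop_step _ k₁ k₂ =>
      obtain ⟨rfl, rfl⟩ := ih₁ k₁
      obtain ⟨rfl, rfl⟩ := ih₂ k₂
      exact ⟨rfl, rfl⟩

/-- The law of an infinite sequence of independent fair coin tosses. -/
noncomputable def coinMeasure : MeasureTheory.Measure (ℕ → Bool) :=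
  MeasureTheory.Measure.infinitePi fun _ => (PMF.uniformOfFintype Bool).toMeasure

end RAM

/-! ## Minimum spanning trees in generalized Hamming spaces

The points `p 0, …, p (n - 1)` of the space `Σ^d`, where `Σ = {0, …, q - 1}`. -/

namespace HammingMST

variable {q n d : ℕ}

/-- The Hamming distance between the two endpoints of an edge. -/
def edgeCost (p : Fin n → Fin d → Fin q) : Sym2 (Fin n) → ℕ :=
  Sym2.lift ⟨fun i j => hammingDist (p i) (p j), fun _ _ => hammingDist_comm _ _⟩

open Classical in
/-- The cost of a graph on the points: the sum of the Hamming lengths of its edges. -/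
noncomputable def cost (p : Fin n → Fin d → Fin q) (T : SimpleGraph (Fin n)) : ℕ :=
  ∑ e ∈ T.edgeFinset, edgeCost p e

/-- `T` is a minimum spanning tree of the points. -/
def IsMST (p : Fin n → Fin d → Fin q) (T : SimpleGraph (Fin n)) : Prop :=
  T.IsTree ∧ ∀ T' : SimpleGraph (Fin n), T'.IsTree → cost p T ≤ cost p T'

/-- The cost of a minimum spanning tree of the points. -/
noncomputable def mstCost (p : Fin n → Fin d → Fin q) : ℕ :=
  sInf {m | ∃ T : SimpleGraph (Fin n), T.IsTree ∧ cost p T = m}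

/-- The initial state on input `p`: register `0` holds `n`, register `1` holds `d`, the memory
holds the `n × d` matrix of the coordinates in row-major order, and everything else is `0`. -/
def inputState (p : Fin n → Fin d → Fin q) : RAM.State where
  reg := fun i => if i = 0 then n else if i = 1 then d else 0
  mem := fun a =>
    if h : a < n * d then
      p ⟨a / d, Nat.div_lt_of_lt_mul (Nat.mul_comm n d ▸ h)⟩
        ⟨a % d, Nat.mod_lt a (Nat.pos_of_ne_zero fun h0 => by simp [h0] at h)⟩
    else 0
  pos := 0

/-- The graph returned in the state `s`: register `0` holds the address of a list of `n - 1` edges,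
each given by its two endpoints in consecutive memory cells. -/
def outputGraph (n : ℕ) (s : RAM.State) : SimpleGraph (Fin n) :=
  SimpleGraph.fromRel fun i j => ∃ k < n - 1,
    s.mem (s.reg 0 + 2 * k) = i ∧ s.mem (s.reg 0 + 2 * k + 1) = j

end HammingMST

/-- The bound `C · f · (log f)^k` behind `Õ(f)`, with `⌊log₂ f⌋ + 1` for the logarithm. -/
def softBound (C k f : ℕ) : ℕ := C * (f * (Nat.log 2 f + 1) ^ k)

/-! Prim's algorithm meets the bound deterministically, so the time event is the whole sample space
and its probability is 1.

Every point of the tree keeps a row of its distances to all `n` points. When `v` is attached to its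
nearest tree point `w`, the row of `v` is not computed from scratch: the distances from `v` and `w`
to a third point can differ only through coordinates in which `v` and `w` themselves differ. Copying
the row of `w` and correcting it in those coordinates takes O(n) steps for each of the `ham(v, w)`
corrections. These edge lengths add up to the cost of the finished tree, which is `M`, so all
corrections together take O(nM). A round otherwise scans the `d` coordinates and passes over the `n`
points a constant number of times. With O(nd) for the first row, the total is O(n(d + n + M))
instructions.

Correctness is the cut property, `PartialMST.sup_edge`, resting on the edge exchange
`IsTree.exists_exchange`. The row correction is `spec_correctProg` and `spec_updateProg`; the
charging of its time to the tree cost is `spec_round`, summed in `spec_rounds`. For the logarithmic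
cost it suffices that stored numbers stay below some `V` polynomial in the input size: each
instruction then costs O(log V), which `Spec` turns into counting instructions. -/

namespace RAM

/-! ### Bounding the logarithmic cost -/

/-- The number of nodes of an expression. -/
def Expr.size : Expr → ℕ
  | .lit _ => 1
  | .reg _ => 1
  | .load a => a.size + 1
  | .add a b => a.size + b.size + 1
  | .sub a b => a.size + b.size + 1
  | .mul a b => a.size + b.size + 1
  | .div a b => a.size + b.size + 1

/-- The largest constant or register index occurring in an expression. -/
def Expr.maxLit : Expr → ℕ
  | .lit k => k
  | .reg i => i
  | .load a => a.maxLit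
  | .add a b => max a.maxLit b.maxLit
  | .sub a b => max a.maxLit b.maxLit
  | .mul a b => max a.maxLit b.maxLit
  | .div a b => max a.maxLit b.maxLit

/-- All numbers stored in the state are at most `V`. -/
def Bounded (V : ℕ) (s : State) : Prop := (∀ i, s.reg i ≤ V) ∧ ∀ a, s.mem a ≤ V

theorem bitLen_mono {x y : ℕ} (h : x ≤ y) : bitLen x ≤ bitLen y :=
  Nat.succ_le_succ (Nat.log_mono_right h)

theorem one_le_bitLen (x : ℕ) : 1 ≤ bitLen x := Nat.succ_le_succ (Nat.zero_le _)

theorem bitLen_pow_le (x : ℕ) {m : ℕ} (hm : m ≠ 0) : bitLen (x ^ m) ≤ m * bitLen x := by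
  have h1 : x < 2 ^ bitLen x := Nat.lt_pow_succ_log_self (by norm_num) x
  have h2 : x ^ m < 2 ^ (m * bitLen x) := by
    rw [mul_comm, pow_mul]
    exact Nat.pow_lt_pow_left h1 hm
  have h3 : m * bitLen x ≠ 0 := Nat.mul_ne_zero hm (Nat.succ_ne_zero _)
  exact Nat.succ_le_of_lt (Nat.log_lt_of_lt_pow' h3 h2)

theorem Expr.size_pos (e : Expr) : 0 < e.size := by
  cases e <;> simp [Expr.size]

/-- Sums and products add exponents at most, and the extra factor `V ≥ 2` for each operation absorbs
the doubling in a sum. A load starts afresh from a number at most `V`. -/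
theorem Expr.eval_le {V : ℕ} (hV : 2 ≤ V) {s : State} (hs : Bounded V s) (e : Expr)
    (he : e.maxLit ≤ V) : e.eval s ≤ V ^ e.size := by
  have hV0 : 0 < V := by omega
  have key : ∀ a b : ℕ, ∀ x y : ℕ, 0 < a → 0 < b → x ≤ V ^ a → y ≤ V ^ b →
      x + y ≤ V ^ (a + b + 1) ∧ x * y ≤ V ^ (a + b + 1) ∧ x ≤ V ^ (a + b + 1) := by
    intro a b x y ha hb hx hy
    have h1 : V ^ a ≤ V ^ (a + b) := Nat.pow_le_pow_right hV0 (by omega)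
    have h2 : V ^ b ≤ V ^ (a + b) := Nat.pow_le_pow_right hV0 (by omega)
    have h3 : 2 * V ^ (a + b) ≤ V ^ (a + b + 1) := by
      rw [pow_succ, mul_comm]
      exact Nat.mul_le_mul_left _ hV
    have h4 : x * y ≤ V ^ (a + b) := by
      rw [pow_add]
      exact Nat.mul_le_mul hx hy
    refine ⟨?_, ?_, ?_⟩ <;> omega
  induction e with
  | lit k => simpa [Expr.size, Expr.eval, Expr.maxLit] using he
  | reg i => simpa [Expr.size, Expr.eval] using hs.1 i
  | load a _ => exact (hs.2 _).trans (Nat.le_self_pow (Nat.succ_ne_zero _) V)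
  | add a b iha ihb =>
    have he' := max_le_iff.1 he
    exact (key _ _ _ _ a.size_pos b.size_pos (iha he'.1) (ihb he'.2)).1
  | sub a b iha ihb =>
    have he' := max_le_iff.1 he
    exact (Nat.sub_le _ _).trans (key _ _ _ _ a.size_pos b.size_pos (iha he'.1) (ihb he'.2)).2.2
  | mul a b iha ihb =>
    have he' := max_le_iff.1 he
    exact (key _ _ _ _ a.size_pos b.size_pos (iha he'.1) (ihb he'.2)).2.1
  | div a b iha ihb =>
    have he' := max_le_iff.1 he
    exact (Nat.div_le_self _ _).trans
      (key _ _ _ _ a.size_pos b.size_pos (iha he'.1) (ihb he'.2)).2.2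

/-- Each node handles a value of length at most its size times `bitLen V`. Summing over the nodes
gives a quadratic bound, in a form that is superadditive enough for the induction. -/
theorem Expr.cost_le {V : ℕ} (hV : 2 ≤ V) {s : State} (hs : Bounded V s) (e : Expr)
    (he : e.maxLit ≤ V) : e.cost s ≤ 2 * e.size ^ 2 * bitLen V := by
  have hval : ∀ e : Expr, e.maxLit ≤ V → bitLen (e.eval s) ≤ e.size * bitLen V := fun e he =>
    (bitLen_mono (e.eval_le hV hs he)).trans (bitLen_pow_le V e.size_pos.ne')
  have key : ∀ a b x y z : ℕ, x ≤ 2 * a ^ 2 * bitLen V → y ≤ 2 * b ^ 2 * bitLen V →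
      z ≤ (a + b + 1) * bitLen V → x + y + z ≤ 2 * (a + b + 1) ^ 2 * bitLen V := by
    intro a b x y z hx hy hz
    have : 2 * a ^ 2 + 2 * b ^ 2 + (a + b + 1) ≤ 2 * (a + b + 1) ^ 2 := by nlinarith
    calc x + y + z ≤ (2 * a ^ 2 + 2 * b ^ 2 + (a + b + 1)) * bitLen V := by
          rw [add_mul, add_mul]; omega
      _ ≤ _ := Nat.mul_le_mul_right _ this
  induction e with
  | lit k =>
    have := bitLen_mono (show k ≤ V from he)
    simp only [Expr.cost, Expr.size]; omega
  | reg i =>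
    have h1 := bitLen_mono (show i ≤ V from he)
    have h2 := bitLen_mono (hs.1 i)
    simp only [Expr.cost, Expr.size]; omega
  | load a iha =>
    have h2 := bitLen_mono (hs.2 (a.eval s))
    have := key a.size 0 _ 0 (bitLen (s.mem (a.eval s))) (iha he) (by simp)
      (h2.trans (Nat.le_mul_of_pos_left _ (by omega)))
    simpa [Expr.cost, Expr.size] using this
  | add a b iha ihb =>
    have he' := max_le_iff.1 he
    exact key _ _ _ _ _ (iha he'.1) (ihb he'.2) (hval (.add a b) he)
  | sub a b iha ihb =>
    have he' := max_le_iff.1 he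
    exact key _ _ _ _ _ (iha he'.1) (ihb he'.2) (hval (.sub a b) he)
  | mul a b iha ihb =>
    have he' := max_le_iff.1 he
    exact key _ _ _ _ _ (iha he'.1) (ihb he'.2) (hval (.mul a b) he)
  | div a b iha ihb =>
    have he' := max_le_iff.1 he
    exact key _ _ _ _ _ (iha he'.1) (ihb he'.2) (hval (.div a b) he)

/-! ### A program logic -/

/-- The registers that a program may change. -/
def Prog.writes : Prog → List ℕ
  | .skip => []
  | .assign i _ => [i]
  | .store _ _ => []
  | .toss i => [i]
  | .seq c₁ c₂ => c₁.writes ++ c₂.writes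
  | .cond _ c₁ c₂ => c₁.writes ++ c₂.writes
  | .loop _ c => c.writes

theorem Runs.reg_eq {ω : ℕ → Bool} {c : Prog} {s s' : State} {t : ℕ} (h : Runs ω c s s' t) {r : ℕ}
    (hr : r ∉ c.writes) : s'.reg r = s.reg r := by
  induction h with
  | skip | store | loop_stop => rfl
  | assign s i e => exact Function.update_of_ne (by simpa [Prog.writes] using hr) _ _
  | toss s i => exact Function.update_of_ne (by simpa [Prog.writes] using hr) _ _
  | seq _ _ ih₁ ih₂ =>
    simp only [Prog.writes, List.mem_append, not_or] at hr
    rw [ih₂ hr.2, ih₁ hr.1]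
  | cond_true _ _ ih =>
    simp only [Prog.writes, List.mem_append, not_or] at hr
    exact ih hr.1
  | cond_false _ _ ih =>
    simp only [Prog.writes, List.mem_append, not_or] at hr
    exact ih hr.2
  | loop_step _ _ _ ih₁ ih₂ => rw [ih₂ hr, ih₁ hr]

/-- An upper bound for the cost of a small instruction when all stored numbers are at most `V`. -/
def unitCost (V : ℕ) : ℕ := 30000 * bitLen V

/-- An expression with few nodes and small constants. -/
def Expr.Small (e : Expr) : Prop := e.size ≤ 80 ∧ e.maxLit ≤ 20

instance (e : Expr) : Decidable e.Small := inferInstanceAs (Decidable (_ ∧ _))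

/-- Here 12800 = 2 · 80². A store evaluates two such expressions, which still fits into the 30000 of
`unitCost`. -/
theorem Expr.Small.cost_le {V : ℕ} (hV : 20 ≤ V) {s : State} (hs : Bounded V s) {e : Expr}
    (he : e.Small) : e.cost s ≤ 12800 * bitLen V := by
  refine (e.cost_le (by omega) hs (he.2.trans hV)).trans (Nat.mul_le_mul_right _ ?_)
  have := Nat.pow_le_pow_left he.1 2
  omega

/-- Started in `s` when `T` units of time have been used, the program `c` halts; if all numbers in
`s` are at most `V`, then so they are afterwards, and the final state and the number of units of
time used until then satisfy `Q`. -/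
def Spec (ω : ℕ → Bool) (V : ℕ) (c : Prog) (s : State) (T : ℕ) (Q : State → ℕ → Prop) : Prop :=
  Bounded V s → ∃ s' t T', Runs ω c s s' t ∧ T * unitCost V + t ≤ T' * unitCost V ∧
    Bounded V s' ∧ (∀ r, r ∉ c.writes → s'.reg r = s.reg r) ∧ Q s' T'

variable {ω : ℕ → Bool} {V : ℕ}

theorem Spec.mono {c : Prog} {s : State} {T : ℕ} {Q Q' : State → ℕ → Prop}
    (h : Spec ω V c s T Q)
    (hQ : ∀ s' T', (∀ r, r ∉ c.writes → s'.reg r = s.reg r) → Q s' T' → Q' s' T') :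
    Spec ω V c s T Q' := by
  intro hs
  obtain ⟨s', t, T', h1, h2, h3, h4, h5⟩ := h hs
  exact ⟨s', t, T', h1, h2, h3, h4, hQ _ _ h4 h5⟩

theorem Spec.skip {s : State} {T : ℕ} {Q : State → ℕ → Prop} (h : Q s (T + 1)) :
    Spec ω V .skip s T Q := by
  intro hs
  have := one_le_bitLen V
  refine ⟨s, 1, T + 1, .skip s, ?_, hs, fun _ _ => rfl, h⟩
  rw [add_mul, unitCost]; omega

theorem Spec.assign (hV : 20 ≤ V) {s : State} {T i : ℕ} {e : Expr} {Q : State → ℕ → Prop}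
    (hi : i ≤ 20) (he : e.Small) (hev : Bounded V s → e.eval s ≤ V)
    (h : Q { s with reg := Function.update s.reg i (e.eval s) } (T + 1)) :
    Spec ω V (.assign i e) s T Q := by
  intro hs
  have h1 := he.cost_le hV hs
  have h2 := bitLen_mono (hi.trans hV)
  have h3 := Runs.assign (ω := ω) s i e
  refine ⟨_, _, T + 1, h3, ?_, ⟨fun r => ?_, hs.2⟩, fun r hr => h3.reg_eq hr, h⟩
  · rw [add_mul, unitCost]; omega
  · by_cases hr : r = i
    · subst hr; simpa using hev hs
    · simpa [hr] using hs.1 r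

theorem Spec.store (hV : 20 ≤ V) {s : State} {T : ℕ} {a e : Expr} {Q : State → ℕ → Prop}
    (ha : a.Small) (he : e.Small) (hev : Bounded V s → e.eval s ≤ V)
    (h : Q { s with mem := Function.update s.mem (a.eval s) (e.eval s) } (T + 1)) :
    Spec ω V (.store a e) s T Q := by
  intro hs
  have h1 := he.cost_le hV hs
  have h2 := ha.cost_le hV hs
  refine ⟨_, _, T + 1, .store s a e, ?_, ⟨hs.1, fun r => ?_⟩, fun _ _ => rfl, h⟩
  · rw [add_mul, unitCost]; omega
  · by_cases hr : r = a.eval s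
    · subst hr; simpa using hev hs
    · simpa [hr] using hs.2 r

theorem Spec.seq {c₁ c₂ : Prog} {s : State} {T : ℕ} {Q : State → ℕ → Prop}
    (h : Spec ω V c₁ s T fun s' T' => Spec ω V c₂ s' T' Q) : Spec ω V (.seq c₁ c₂) s T Q := by
  intro hs
  obtain ⟨s₁, t₁, T₁, h1, h2, h3, _, h4⟩ := h hs
  obtain ⟨s₂, t₂, T₂, k1, k2, k3, _, k4⟩ := h4 h3
  exact ⟨s₂, _, T₂, h1.seq k1, by omega, k3, fun r hr => (h1.seq k1).reg_eq hr, k4⟩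

theorem Spec.cond (hV : 20 ≤ V) {c₁ c₂ : Prog} {e : Expr} {s : State} {T : ℕ}
    {Q : State → ℕ → Prop} (he : e.Small)
    (h₁ : e.eval s ≠ 0 → Spec ω V c₁ s (T + 1) Q) (h₂ : e.eval s = 0 → Spec ω V c₂ s (T + 1) Q) :
    Spec ω V (.cond e c₁ c₂) s T Q := by
  intro hs
  have h0 := he.cost_le hV hs
  have h0' : e.cost s ≤ unitCost V := by rw [unitCost]; omega
  by_cases hz : e.eval s = 0
  · obtain ⟨s', t, T', k1, k2, k3, _, k4⟩ := h₂ hz hs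
    rw [add_mul] at k2
    exact ⟨s', _, T', .cond_false hz k1, by omega, k3,
      fun r hr => (Runs.cond_false (c₁ := c₁) hz k1).reg_eq hr, k4⟩
  · obtain ⟨s', t, T', k1, k2, k3, _, k4⟩ := h₁ hz hs
    rw [add_mul] at k2
    exact ⟨s', _, T', .cond_true hz k1, by omega, k3,
      fun r hr => (Runs.cond_true (c₂ := c₂) hz k1).reg_eq hr, k4⟩

/-- `for R[i] := 0 to R[b] - 1 do c` -/
def Prog.forLoop (i b : ℕ) (c : Prog) : Prog :=
  .seq (.assign i (.lit 0))
    (.loop (.sub (.reg b) (.reg i)) (.seq c (.assign i (.add (.reg i) (.lit 1)))))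

/-- Each round is charged two units beyond its body, for the test and the increment; initialization
and the final test cost one each. The invariant must ignore register `i` (`hcongr`), because the
counter changes after the body has established it. -/
theorem Spec.forLoop (hV : 20 ≤ V) {i b : ℕ} {c : Prog} {s : State} {T : ℕ}
    {Q : State → ℕ → Prop} (N : ℕ) (Inv : ℕ → State → ℕ → Prop)
    (hi : i ≤ 20) (hb : b ≤ 20) (hib : b ≠ i) (hic : i ∉ c.writes) (hbc : b ∉ c.writes)
    (hN : s.reg b = N)
    (hcongr : ∀ k s x T, Inv k s T → Inv k { s with reg := Function.update s.reg i x } T)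
    (h0 : Inv 0 s (T + 1))
    (hstep : ∀ k s' T', k < N → Inv k s' T' → s'.reg i = k →
      (∀ r, r ≠ i → r ∉ c.writes → s'.reg r = s.reg r) →
      Spec ω V c s' (T' + 1) fun s'' T'' => Inv (k + 1) s'' (T'' + 1))
    (hQ : ∀ s' T', Inv N s' T' → (∀ r, r ≠ i → r ∉ c.writes → s'.reg r = s.reg r) →
      Q s' (T' + 1)) :
    Spec ω V (.forLoop i b c) s T Q := by
  have small1 : (Expr.sub (.reg b) (.reg i)).Small := ⟨by simp [Expr.size], by
    simp [Expr.maxLit, hb, hi]⟩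
  have small2 : (Expr.add (.reg i) (.lit 1)).Small := ⟨by simp [Expr.size], by
    simp [Expr.maxLit, hi]⟩
  have main : ∀ m k s' T', k + m = N → Inv k s' T' → s'.reg i = k →
      (∀ r, r ≠ i → r ∉ c.writes → s'.reg r = s.reg r) →
      Spec ω V (.loop (.sub (.reg b) (.reg i)) (.seq c (.assign i (.add (.reg i) (.lit 1)))))
        s' T' Q := by
    intro m
    induction m with
    | zero =>
      intro k s' T' hk hInv hik hfr hs
      have h1 := small1.cost_le hV hs
      have hz : (Expr.sub (.reg b) (.reg i)).eval s' = 0 := by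
        simp only [Expr.eval, hik, hfr b hib hbc, hN]; omega
      refine ⟨s', _, T' + 1, Runs.loop_stop hz, ?_, hs, fun _ _ => rfl, hQ _ _ ?_ hfr⟩
      · rw [add_mul, unitCost]; omega
      · obtain rfl : k = N := by omega
        exact hInv
    | succ m ih =>
      intro k s' T' hk hInv hik hfr hs
      have h1 := small1.cost_le hV hs
      have hz : (Expr.sub (.reg b) (.reg i)).eval s' ≠ 0 := by
        simp only [Expr.eval, hik, hfr b hib hbc, hN]; omega
      -- The bound `N` sits in a register, so the incremented counter, at most `N`, respects `V` as
      -- well.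
      have hNV : N ≤ V := by
        have := hs.1 b
        rwa [hfr b hib hbc, hN] at this
      have h2 : Spec ω V (.seq c (.assign i (.add (.reg i) (.lit 1)))) s' (T' + 1)
          fun s'' T'' => Inv (k + 1) s'' T'' ∧ s''.reg i = k + 1 ∧
            ∀ r, r ≠ i → r ∉ c.writes → s''.reg r = s.reg r := by
        refine Spec.seq ((hstep k s' T' (by omega) hInv hik hfr).mono fun s₁ T₁ hfr₁ hInv₁ => ?_)
        have hi₁ : s₁.reg i = k := by rw [hfr₁ i hic, hik]
        refine Spec.assign hV hi small2 (fun _ => ?_) ⟨hcongr _ _ _ _ hInv₁, ?_, ?_⟩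
        · simp only [Expr.eval, hi₁]; omega
        · simp [Expr.eval, hi₁]
        · intro r hr hrc
          simp [hr, hfr₁ r hrc, hfr r hr hrc]
      obtain ⟨s₁, t₁, T₁, k1, k2, k3, -, k4, k5, k6⟩ := h2 hs
      obtain ⟨s₂, t₂, T₂, l1, l2, l3, -, l4⟩ := ih (k + 1) s₁ T₁ (by omega) k4 k5 k6 k3
      have hr := Runs.loop_step hz k1 l1
      refine ⟨s₂, _, T₂, hr, ?_, l3, fun r h => hr.reg_eq h, l4⟩
      rw [add_mul] at k2
      have : (Expr.sub (.reg b) (.reg i)).cost s' ≤ unitCost V := by rw [unitCost]; omega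
      omega
  refine Spec.seq (Spec.assign hV hi ⟨by simp [Expr.size], by simp [Expr.maxLit]⟩
    (fun _ => Nat.zero_le _) (main N 0 _ _ (zero_add N) (hcongr _ _ _ _ h0) ?_ ?_))
  · simp [Expr.eval]
  · intro r hr _
    simp [hr]

end RAM

/-! ### Prim's rule -/

namespace SimpleGraph

open Classical in
/-- Replacing an edge that leaves `S` on the path of a tree between `w ∈ S` and `v ∉ S` by the edge
between `w` and `v` yields a tree. -/
theorem IsTree.exists_exchange {V : Type*} [Fintype V] {T : SimpleGraph V} (hT : T.IsTree)
    {S : Set V} {v w : V} (hw : w ∈ S) (hv : v ∉ S) (hadj : ¬ T.Adj v w) :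
    ∃ a b, a ∈ S ∧ b ∉ S ∧ T.Adj a b ∧ ∃ T' : SimpleGraph V, T'.IsTree ∧
      ∀ e, e ∈ T'.edgeSet ↔ e = s(v, w) ∨ e ≠ s(a, b) ∧ e ∈ T.edgeSet := by
  have hvw : v ≠ w := fun h => hv (h ▸ hw)
  obtain ⟨p, hp⟩ := hT.connected.exists_isPath w v
  -- The tree path starts in `S` and ends outside, so some edge of it leaves `S`.
  obtain ⟨⟨⟨a, b⟩, hab⟩, hd, ha, hb⟩ := p.exists_boundary_dart S hw hv
  simp only at ha hb
  have habp : s(a, b) ∈ p.edges := List.mem_map_of_mem (f := Dart.edge) hd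
  have hne : s(a, b) ≠ s(v, w) := by
    intro h
    have : s(a, b) ∈ T.edgeSet := hab
    rw [h] at this
    exact hadj this
  set H := T ⊔ edge v w with hH
  have hle : T ≤ H := le_sup_left
  have hHadj : H.Adj v w := Or.inr (by simp [edge_adj, hvw])
  have hHE : H.edgeFinset = insert s(v, w) T.edgeFinset := by
    ext e
    simp only [mem_edgeFinset, hH, edgeSet_sup, edgeSet_edge_of_ne hvw, Finset.mem_insert,
      Set.mem_union, Set.mem_singleton_iff]
    tauto
  -- The new edge closes the tree path to a cycle through `s(a, b)`; deleting that edge therefore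
  -- keeps the graph connected.
  have hbr : ¬ H.IsBridge s(a, b) := by
    have hmem : s(a, b) ∈ H.edgeSet := hle hab
    rw [isBridge_iff_forall_cycle_notMem hmem]
    intro h
    refine h (Walk.cons hHadj (p.mapLe hle)) ?_ ?_
    · rw [Walk.cons_isCycle_iff]
      refine ⟨hp.mapLe hle, ?_⟩
      rw [Walk.edges_mapLe_eq_edges]
      exact fun h => hadj (p.edges_subset_edgeSet h)
    · rw [Walk.edges_cons, Walk.edges_mapLe_eq_edges]
      exact List.mem_cons_of_mem _ habp
  have hconn := (hT.connected.mono hle).connected_delete_edge_of_not_isBridge hbr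
  have hE : (H.deleteEdges {s(a, b)}).edgeFinset =
      insert s(v, w) (T.edgeFinset.erase s(a, b)) := by
    ext e
    simp only [mem_edgeFinset, edgeSet_deleteEdges, Finset.mem_insert, Finset.mem_erase,
      Set.mem_sdiff, Set.mem_singleton_iff]
    rw [← mem_edgeFinset, hHE, Finset.mem_insert, mem_edgeFinset]
    constructor
    · rintro ⟨h | h, h'⟩
      · exact Or.inl h
      · exact Or.inr ⟨h', h⟩
    · rintro (h | ⟨h, h'⟩)
      · exact ⟨Or.inl h, fun h' => hne (h' ▸ h)⟩
      · exact ⟨Or.inr h', h⟩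
  refine ⟨a, b, ha, hb, hab, H.deleteEdges {s(a, b)}, ?_, fun e => by
    rw [← mem_edgeFinset, hE, Finset.mem_insert, Finset.mem_erase, mem_edgeFinset]⟩
  rw [isTree_iff_connected_and_card]
  refine ⟨hconn, ?_⟩
  have hcard := hT.card_edgeFinset
  rw [Nat.card_eq_fintype_card, ← edgeFinset_card, hE, Finset.card_insert_of_notMem,
    Finset.card_erase_of_mem, Nat.card_eq_fintype_card, ← hcard]
  · have : 0 < T.edgeFinset.card := Finset.card_pos.2 ⟨s(a, b), by simpa using hab⟩
    omega
  · simpa using hab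
  · simp [hadj]

end SimpleGraph

/-! ### Partial minimum spanning trees and the cut property -/

namespace HammingMST

open SimpleGraph

variable {q n d : ℕ} {p : Fin n → Fin d → Fin q}

theorem cost_eq (p : Fin n → Fin d → Fin q) (T : SimpleGraph (Fin n)) [Fintype T.edgeSet] :
    cost p T = ∑ e ∈ T.edgeFinset, edgeCost p e :=
  Finset.sum_congr (by ext; simp) fun _ _ => rfl

theorem exists_isMST (hn : 0 < n) (p : Fin n → Fin d → Fin q) : ∃ T, IsMST p T := by
  have : Nonempty (Fin n) := ⟨⟨0, hn⟩⟩
  have hne : {T : SimpleGraph (Fin n) | T.IsTree}.Nonempty := by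
    obtain ⟨T, -, hT⟩ := (connected_top (V := Fin n)).exists_isTree_le
    exact ⟨T, hT⟩
  obtain ⟨T, hT, hmin⟩ := Set.exists_min_image _ (cost p) (Set.toFinite _) hne
  exact ⟨T, hT, hmin⟩

theorem IsMST.mstCost_eq {T : SimpleGraph (Fin n)} (h : IsMST p T) : mstCost p = cost p T := by
  refine le_antisymm (Nat.sInf_le ⟨T, h.1, rfl⟩) (le_csInf ⟨_, T, h.1, rfl⟩ ?_)
  rintro _ ⟨T', hT', rfl⟩
  exact h.2 T' hT'

/-- `F` is a forest with `k` edges within `S` that is contained in a minimum spanning tree. -/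
structure PartialMST (p : Fin n → Fin d → Fin q) (S : Set (Fin n)) (k : ℕ)
    (F : SimpleGraph (Fin n)) : Prop where
  mem_of_adj : ∀ a b, F.Adj a b → a ∈ S
  ncard : F.edgeSet.ncard = k
  exists_le : ∃ T, IsMST p T ∧ F ≤ T

theorem PartialMST.bot (hn : 0 < n) (S : Set (Fin n)) : PartialMST p S 0 ⊥ := by
  classical
  obtain ⟨T, hT⟩ := exists_isMST hn p
  exact ⟨fun _ _ h => h.elim, by simp, T, hT, bot_le⟩

theorem PartialMST.isMST {S : Set (Fin n)} {F : SimpleGraph (Fin n)}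
    (h : PartialMST p S (n - 1) F) : IsMST p F := by
  classical
  obtain ⟨T, hT, hle⟩ := h.exists_le
  have h1 := hT.1.card_edgeFinset
  rw [Fintype.card_fin] at h1
  have h2 : F.edgeFinset = T.edgeFinset := by
    refine Finset.eq_of_subset_of_card_le (edgeFinset_mono hle) ?_
    have := h.ncard
    rw [← coe_edgeFinset, Set.ncard_coe_finset] at this
    omega
  rw [edgeFinset_inj.1 h2]
  exact hT

/-- The cut property: if the minimum spanning tree `T` above `F` lacks the edge `vw`, exchange for
it an edge of `T` leaving `S`. That edge is at least as long, so the new tree is again minimum. -/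
theorem PartialMST.sup_edge {S : Set (Fin n)} {k : ℕ} {F : SimpleGraph (Fin n)}
    (h : PartialMST p S k F) {v w : Fin n} (hw : w ∈ S) (hv : v ∉ S)
    (hmin : ∀ a ∈ S, ∀ b ∉ S, hammingDist (p v) (p w) ≤ hammingDist (p a) (p b)) :
    PartialMST p (insert v S) (k + 1) (F ⊔ edge v w) ∧
      cost p (F ⊔ edge v w) = cost p F + hammingDist (p v) (p w) := by
  classical
  have hvw : v ≠ w := fun h => hv (h ▸ hw)
  have hF : ¬ F.Adj v w := fun h' => hv (h.mem_of_adj _ _ h')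
  have hFE : (F ⊔ edge v w).edgeFinset = insert s(v, w) F.edgeFinset := by
    ext e
    simp only [mem_edgeFinset, edgeSet_sup, edgeSet_edge_of_ne hvw, Finset.mem_insert,
      Set.mem_union, Set.mem_singleton_iff]
    tauto
  refine ⟨⟨?_, ?_, ?_⟩, ?_⟩
  · rintro a b (hab | hab)
    · exact Or.inr (h.mem_of_adj _ _ hab)
    · rw [edge_adj] at hab
      rcases hab.1 with ⟨rfl, -⟩ | ⟨rfl, -⟩
      · exact Or.inl rfl
      · exact Or.inr hw
  · rw [← coe_edgeFinset, hFE, Set.ncard_coe_finset,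
      Finset.card_insert_of_notMem (by simpa using hF), ← Set.ncard_coe_finset, coe_edgeFinset, h.ncard]
  · obtain ⟨T, hT, hle⟩ := h.exists_le
    by_cases hadj : T.Adj v w
    · exact ⟨T, hT, sup_le hle (by rw [edge_le_iff]; exact Or.inr hadj)⟩
    · obtain ⟨a, b, ha, hb, hab, T', hT', hE⟩ := hT.1.exists_exchange hw hv hadj
      have hE' : T'.edgeFinset = insert s(v, w) (T.edgeFinset.erase s(a, b)) := by
        ext e
        simp [hE]
      refine ⟨T', ⟨hT', fun T'' hT'' => le_trans ?_ (hT.2 T'' hT'')⟩, sup_le ?_ ?_⟩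
      · rw [cost_eq, cost_eq, hE', Finset.sum_insert (by simp [hadj]),
          ← Finset.add_sum_erase T.edgeFinset (edgeCost p) (a := s(a, b)) (by simpa using hab)]
        exact Nat.add_le_add_right (hmin a ha b hb) _
      · intro x y hxy
        rw [← mem_edgeSet, hE]
        -- The removed edge has an end outside `S`, while all edges of `F` lie within `S`, so `F`
        -- survives the exchange.
        refine Or.inr ⟨fun h' => ?_, hle hxy⟩
        rw [← mem_edgeSet, h'] at hxy
        exact hb (h.mem_of_adj _ _ hxy.symm)
      · rw [edge_le_iff, ← mem_edgeSet, hE]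
        exact Or.inr (Or.inl rfl)
  · rw [cost_eq, cost_eq, hFE, Finset.sum_insert (by simpa using hF), add_comm]
    rfl

end HammingMST

namespace HammingMST

open RAM

/-! ### The layout of the memory -/

/-- The memory `m` holds the coordinates `x`, a mark `inn j` and a neighbour `par j` for each point
`j`, a list `e` of endpoints of edges, and a matrix `row` of distances. -/
structure Layout (n d : ℕ) (x : ℕ → ℕ → ℕ) (inn par e : ℕ → ℕ) (row : ℕ → ℕ → ℕ) (m : ℕ → ℕ) :
    Prop where
  x_eq : ∀ v < n, ∀ c < d, m (v * d + c) = x v c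
  inn_eq : ∀ j < n, m (n * d + j) = inn j
  par_eq : ∀ j < n, m (n * d + n + j) = par j
  e_eq : ∀ i < 2 * n, m (n * d + 2 * n + i) = e i
  row_eq : ∀ v, ∀ j < n, m (n * d + 4 * n + (v * n + j)) = row v j

theorem mul_add_lt_mul {n d v c : ℕ} (hv : v < n) (hc : c < d) : v * d + c < n * d :=
  calc v * d + c < (v + 1) * d := by rw [Nat.succ_mul]; omega
    _ ≤ n * d := Nat.mul_le_mul_right _ hv

theorem mul_add_inj {n v v' j j' : ℕ} (hj : j < n) (hj' : j' < n) (h : v * n + j = v' * n + j') :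
    v = v' ∧ j = j' := by
  have hn : 0 < n := by omega
  have h1 := congrArg (· / n) h
  simp only [Nat.mul_comm _ n, Nat.mul_add_div hn, Nat.div_eq_of_lt hj, Nat.div_eq_of_lt hj'] at h1
  obtain rfl : v = v' := by omega
  exact ⟨rfl, by omega⟩

section Layout

variable {n d : ℕ} {x : ℕ → ℕ → ℕ} {inn par e : ℕ → ℕ} {row : ℕ → ℕ → ℕ} {m : ℕ → ℕ}

/-- The blocks of the layout occupy disjoint address ranges, so a write within one block leaves the
others intact; likewise for the next three lemmas. The matrix comes last and needs no bound on its
row index. -/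
theorem Layout.set_inn (h : Layout n d x inn par e row m) {i : ℕ} (hi : i < n) (z : ℕ) :
    Layout n d x (Function.update inn i z) par e row (Function.update m (n * d + i) z) where
  x_eq v hv c hc := by
    have := mul_add_lt_mul hv hc
    rw [Function.update_of_ne (by omega), h.x_eq v hv c hc]
  inn_eq j hj := by
    by_cases hji : j = i
    · simp [hji]
    · rw [Function.update_of_ne (by omega), Function.update_of_ne hji, h.inn_eq j hj]
  par_eq j hj := by rw [Function.update_of_ne (by omega), h.par_eq j hj]
  e_eq j hj := by rw [Function.update_of_ne (by omega), h.e_eq j hj]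
  row_eq v j hj := by rw [Function.update_of_ne (by omega), h.row_eq v j hj]

theorem Layout.set_par (h : Layout n d x inn par e row m) {i : ℕ} (hi : i < n) (z : ℕ) :
    Layout n d x inn (Function.update par i z) e row (Function.update m (n * d + n + i) z) where
  x_eq v hv c hc := by
    have := mul_add_lt_mul hv hc
    rw [Function.update_of_ne (by omega), h.x_eq v hv c hc]
  inn_eq j hj := by rw [Function.update_of_ne (by omega), h.inn_eq j hj]
  par_eq j hj := by
    by_cases hji : j = i
    · simp [hji]
    · rw [Function.update_of_ne (by omega), Function.update_of_ne hji, h.par_eq j hj]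
  e_eq j hj := by rw [Function.update_of_ne (by omega), h.e_eq j hj]
  row_eq v j hj := by rw [Function.update_of_ne (by omega), h.row_eq v j hj]

theorem Layout.set_e (h : Layout n d x inn par e row m) {i : ℕ} (hi : i < 2 * n) (z : ℕ) :
    Layout n d x inn par (Function.update e i z) row (Function.update m (n * d + 2 * n + i) z) where
  x_eq v hv c hc := by
    have := mul_add_lt_mul hv hc
    rw [Function.update_of_ne (by omega), h.x_eq v hv c hc]
  inn_eq j hj := by rw [Function.update_of_ne (by omega), h.inn_eq j hj]
  par_eq j hj := by rw [Function.update_of_ne (by omega), h.par_eq j hj]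
  e_eq j hj := by
    by_cases hji : j = i
    · simp [hji]
    · rw [Function.update_of_ne (by omega), Function.update_of_ne hji, h.e_eq j hj]
  row_eq v j hj := by rw [Function.update_of_ne (by omega), h.row_eq v j hj]

theorem Layout.set_row (h : Layout n d x inn par e row m) (v : ℕ) {i : ℕ} (hi : i < n) (z : ℕ) :
    Layout n d x inn par e (Function.update row v (Function.update (row v) i z))
      (Function.update m (n * d + 4 * n + (v * n + i)) z) where
  x_eq v hv c hc := by
    have := mul_add_lt_mul hv hc
    rw [Function.update_of_ne (by omega), h.x_eq v hv c hc]
  inn_eq j hj := by rw [Function.update_of_ne (by omega), h.inn_eq j hj]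
  par_eq j hj := by rw [Function.update_of_ne (by omega), h.par_eq j hj]
  e_eq j hj := by rw [Function.update_of_ne (by omega), h.e_eq j hj]
  row_eq w j hj := by
    by_cases hw : w = v
    · subst hw
      by_cases hji : j = i
      · simp [hji]
      · rw [Function.update_of_ne (by omega), Function.update_self, Function.update_of_ne hji,
          h.row_eq w j hj]
    · rw [Function.update_of_ne, Function.update_of_ne hw, h.row_eq w j hj]
      intro h'
      exact hw (mul_add_inj hj hi (by omega)).1

end Layout

/-- The number of coordinates below `c` in which the points `a` and `b` differ. -/
def prefixDist (x : ℕ → ℕ → ℕ) (a b c : ℕ) : ℕ :=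
  ∑ i ∈ Finset.range c, if x a i = x b i then 0 else 1

section prefixDist

variable (x : ℕ → ℕ → ℕ) (a b : ℕ)

@[simp] theorem prefixDist_zero : prefixDist x a b 0 = 0 := rfl

theorem prefixDist_succ (c : ℕ) :
    prefixDist x a b (c + 1) = prefixDist x a b c + if x a c = x b c then 0 else 1 :=
  Finset.sum_range_succ _ _

theorem prefixDist_mono {c c' : ℕ} (h : c ≤ c') : prefixDist x a b c ≤ prefixDist x a b c' :=
  Finset.sum_le_sum_of_subset (Finset.range_mono h)

theorem prefixDist_le (c : ℕ) : prefixDist x a b c ≤ c := by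
  induction c with
  | zero => simp
  | succ c ih => rw [prefixDist_succ]; split <;> omega

theorem prefixDist_comm (c : ℕ) : prefixDist x a b c = prefixDist x b a c :=
  Finset.sum_congr rfl fun _ _ => by simp only [eq_comm]

end prefixDist

/-! ### The program -/

/-- Coordinate `c` of the point `v`. -/
abbrev ptE (v c : Expr) : Expr := .load (.add (.mul v (.reg 1)) c)

/-- Nonzero if and only if `a` and `b` differ. -/
abbrev neE (a b : Expr) : Expr := .add (.sub a b) (.sub b a)

/-- `1` if `a` and `b` differ, else `0`. -/
abbrev neqE (a b : Expr) : Expr := .sub (.lit 1) (.sub (.lit 1) (neE a b))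

/-- The address of the mark of `j`. -/
abbrev innE (j : Expr) : Expr := .add (.reg 2) j

/-- The address of the neighbour of `j`. -/
abbrev parE (j : Expr) : Expr := .add (.add (.reg 2) (.reg 0)) j

/-- The address of the entry `i` of the list of edges. -/
abbrev edgeE (i : Expr) : Expr := .add (.add (.reg 2) (.mul (.lit 2) (.reg 0))) i

/-- The address of the entry `(v, j)` of the matrix of distances. -/
abbrev rowE (v j : Expr) : Expr :=
  .add (.add (.reg 2) (.mul (.lit 4) (.reg 0))) (.add (.mul v (.reg 0)) j)

/-- Compute the distance between the point `R[3]` and the point `R[6]`. -/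
def distProg : Prog :=
  .forLoop 5 1 (.cond (neE (ptE (.reg 3) (.reg 5)) (ptE (.reg 6) (.reg 5)))
    (.store (rowE (.reg 3) (.reg 6)) (.add (.load (rowE (.reg 3) (.reg 6))) (.lit 1))) .skip)

/-- Compute the distances between the point `R[3]` and all points. -/
def firstRowProg : Prog := .forLoop 6 0 distProg

/-- Make `R[3]` the neighbour of `R[6]` if it is nearer than the present one. -/
def relaxProg : Prog :=
  .cond (.sub (.load (rowE (.load (parE (.reg 6))) (.reg 6))) (.load (rowE (.reg 3) (.reg 6))))
    (.store (parE (.reg 6)) (.reg 3)) .skip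

/-- Update all neighbours by the new point `R[3]` of the tree, and let `R[7]` be the point outside
the tree that is nearest to its neighbour. -/
def selectProg : Prog :=
  .seq (.assign 8 (.add (.reg 1) (.lit 1))) (.forLoop 6 0
    (.cond (.load (innE (.reg 6))) .skip
      (.seq relaxProg
        (.seq (.assign 11 (.load (rowE (.load (parE (.reg 6))) (.reg 6))))
          (.cond (.sub (.reg 8) (.reg 11)) (.seq (.assign 7 (.reg 6)) (.assign 8 (.reg 11)))
            .skip)))))

/-- Attach the point `R[7]` to its neighbour, as the edge number `R[9]`. -/
def attachProg : Prog :=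
  .seq (.assign 3 (.reg 7)) (.seq (.assign 4 (.load (parE (.reg 3))))
    (.seq (.store (innE (.reg 3)) (.lit 1))
      (.seq (.store (edgeE (.mul (.lit 2) (.reg 9))) (.reg 3))
        (.store (edgeE (.add (.mul (.lit 2) (.reg 9)) (.lit 1))) (.reg 4)))))

/-- Copy the distances of `R[4]` to those of `R[3]`. -/
def copyProg : Prog :=
  .forLoop 6 0 (.store (rowE (.reg 3) (.reg 6)) (.load (rowE (.reg 4) (.reg 6))))

/-- Correct the distances of `R[3]` in the coordinate `R[5]`. -/
def correctProg : Prog :=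
  .forLoop 6 0 (.store (rowE (.reg 3) (.reg 6))
    (.sub (.add (.load (rowE (.reg 3) (.reg 6)))
      (neqE (ptE (.reg 3) (.reg 5)) (ptE (.reg 6) (.reg 5))))
      (neqE (ptE (.reg 4) (.reg 5)) (ptE (.reg 6) (.reg 5)))))

/-- Correct the distances of `R[3]` in all coordinates in which it differs from `R[4]`. -/
def updateProg : Prog :=
  .forLoop 5 1 (.cond (neE (ptE (.reg 3) (.reg 5)) (ptE (.reg 4) (.reg 5))) correctProg .skip)

/-- Prim's algorithm. When a point is attached to the tree, its distances to all points are
obtained from those of its neighbour by correcting them in the coordinates in which the two points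
differ; over the whole run there are as many such coordinates as the tree costs. Hence no coin
tosses are needed, and the time bound holds for every outcome. -/
def mstProg : Prog :=
  .seq (.assign 2 (.mul (.reg 0) (.reg 1))) (.seq (.assign 10 (.sub (.reg 0) (.lit 1)))
    (.seq firstRowProg (.seq (.store (innE (.reg 3)) (.lit 1))
      (.seq (.forLoop 9 10 (.seq selectProg (.seq attachProg (.seq copyProg updateProg))))
        (.assign 0 (edgeE (.lit 0)))))))

theorem eval_neE_eq_zero {s : State} {a b : Expr} :
    (neE a b).eval s = 0 ↔ a.eval s = b.eval s := by
  simp only [Expr.eval]; omega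

theorem eval_neqE {s : State} {a b : Expr} :
    (neqE a b).eval s = if a.eval s = b.eval s then 0 else 1 := by
  simp only [Expr.eval]; split <;> omega

/-! ### Verification -/

/-- The registers `0`, `1`, `2` hold `n`, `d` and `n * d`. -/
structure Params (n d : ℕ) (s : State) : Prop where
  r0 : s.reg 0 = n
  r1 : s.reg 1 = d
  r2 : s.reg 2 = n * d

theorem Params.congr {n d : ℕ} {s s' : State} (h : Params n d s) (h0 : s'.reg 0 = s.reg 0)
    (h1 : s'.reg 1 = s.reg 1) (h2 : s'.reg 2 = s.reg 2) : Params n d s' :=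
  ⟨h0.trans h.r0, h1.trans h.r1, h2.trans h.r2⟩

section Verification

variable {ω : ℕ → Bool} {V n d : ℕ} {x : ℕ → ℕ → ℕ} {inn par e : ℕ → ℕ} {row : ℕ → ℕ → ℕ}
  {s : State} {T v w : ℕ}

section eval

variable {a b : Expr}

theorem eval_ptE (hP : Params n d s) (hL : Layout n d x inn par e row s.mem)
    (hv : a.eval s = v) {c : ℕ} (hc : b.eval s = c) (hvn : v < n) (hcd : c < d) :
    (ptE a b).eval s = x v c := by
  simp only [Expr.eval, hv, hc, hP.r1]
  exact hL.x_eq v hvn c hcd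

theorem eval_rowE (hP : Params n d s) (hv : a.eval s = v) {j : ℕ} (hj : b.eval s = j) :
    (rowE a b).eval s = n * d + 4 * n + (v * n + j) := by
  simp only [Expr.eval, hv, hj, hP.r0, hP.r2]

theorem eval_load_rowE (hP : Params n d s) (hL : Layout n d x inn par e row s.mem)
    (hv : a.eval s = v) {j : ℕ} (hj : b.eval s = j) (hjn : j < n) :
    (Expr.load (rowE a b)).eval s = row v j := by
  rw [Expr.eval, eval_rowE hP hv hj]
  exact hL.row_eq v j hjn

theorem eval_parE (hP : Params n d s) {j : ℕ} (hj : a.eval s = j) :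
    (parE a).eval s = n * d + n + j := by
  simp only [Expr.eval, hj, hP.r0, hP.r2]

theorem eval_load_parE (hP : Params n d s) (hL : Layout n d x inn par e row s.mem)
    {j : ℕ} (hj : a.eval s = j) (hjn : j < n) : (Expr.load (parE a)).eval s = par j := by
  rw [Expr.eval, eval_parE hP hj]
  exact hL.par_eq j hjn

end eval

/-- The matrix cell itself serves as the counter, which is why it has to be zero at the start. -/
theorem spec_distProg (hV : 20 ≤ V) (hd : d ≤ V) (hP : Params n d s)
    (hL : Layout n d x inn par e row s.mem) (h3 : s.reg 3 = v) (hv : v < n) {j : ℕ}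
    (h6 : s.reg 6 = j) (hj : j < n) (hrow : row v j = 0) :
    Spec ω V distProg s T fun s' T' => T' ≤ T + 4 * d + 2 ∧ ∃ row',
      Layout n d x inn par e row' s'.mem ∧ row' v j = prefixDist x v j d ∧
        ∀ b, b ≠ j → row' v b = row v b := by
  refine Spec.forLoop hV d (fun k s' T' => T' ≤ T + 4 * k + 1 ∧ ∃ row',
      Layout n d x inn par e row' s'.mem ∧ row' v j = prefixDist x v j k ∧
        ∀ b, b ≠ j → row' v b = row v b) (by norm_num) (by norm_num) (by norm_num) (by decide)
    (by decide) hP.r1 (fun _ _ _ _ h => h) ⟨by omega, row, hL, by simpa using hrow, fun _ _ => rfl⟩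
    ?_ ?_
  · rintro k s' T' hk ⟨hT, row', hL', hkj, hb⟩ hi hfr
    have hP' : Params n d s' := hP.congr (hfr _ (by decide) (by decide))
      (hfr _ (by decide) (by decide)) (hfr _ (by decide) (by decide))
    have h3' : s'.reg 3 = v := (hfr _ (by decide) (by decide)).trans h3
    have h6' : s'.reg 6 = j := (hfr _ (by decide) (by decide)).trans h6
    have e1 := eval_ptE (a := .reg 3) (b := .reg 5) hP' hL' h3' hi hv hk
    have e2 := eval_ptE (a := .reg 6) (b := .reg 5) hP' hL' h6' hi hj hk
    have e3 := eval_load_rowE (a := .reg 3) (b := .reg 6) hP' hL' h3' h6' hj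
    refine Spec.cond hV (by decide) (fun h => ?_) (fun h => ?_)
    · rw [Ne, eval_neE_eq_zero, e1, e2] at h
      have e4 : (Expr.add (.load (rowE (.reg 3) (.reg 6))) (.lit 1)).eval s' =
          prefixDist x v j (k + 1) := by
        rw [Expr.eval, e3, hkj, prefixDist_succ, if_neg h]; rfl
      have := prefixDist_le x v j (k + 1)
      refine Spec.store hV (by decide) (by decide) (fun _ => by omega) ⟨by omega,
        Function.update row' v (Function.update (row' v) j (prefixDist x v j (k + 1))), ?_, ?_, ?_⟩
      · rw [e4, eval_rowE hP' (a := .reg 3) (b := .reg 6) h3' h6']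
        exact hL'.set_row v hj _
      · simp
      · intro b hbj
        simpa [hbj] using hb b hbj
    · rw [eval_neE_eq_zero, e1, e2] at h
      exact Spec.skip ⟨by omega, row', hL', by rw [prefixDist_succ, if_pos h, hkj]; rfl, hb⟩
  · rintro s' T' ⟨hT, h⟩ _
    exact ⟨by omega, h⟩

theorem spec_firstRowProg (hV : 20 ≤ V) (hd : d ≤ V) (hP : Params n d s)
    (hL : Layout n d x inn par e row s.mem) (h3 : s.reg 3 = v) (hv : v < n)
    (hrow : ∀ j, row v j = 0) :
    Spec ω V firstRowProg s T fun s' T' => T' ≤ T + n * (4 * d + 4) + 2 ∧ ∃ row',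
      Layout n d x inn par e row' s'.mem ∧ ∀ j < n, row' v j = prefixDist x v j d := by
  refine Spec.forLoop hV n (fun k s' T' => T' ≤ T + k * (4 * d + 4) + 1 ∧ ∃ row',
      Layout n d x inn par e row' s'.mem ∧ (∀ j < k, row' v j = prefixDist x v j d) ∧
        ∀ j, k ≤ j → row' v j = 0) (by norm_num) (by norm_num) (by norm_num) (by decide)
    (by decide) hP.r0 (fun _ _ _ _ h => h) ⟨by omega, row, hL, by simp, fun j _ => hrow j⟩ ?_ ?_
  · rintro k s' T' hk ⟨hT, row', hL', h1, h2⟩ hi hfr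
    have hP' : Params n d s' := hP.congr (hfr _ (by decide) (by decide))
      (hfr _ (by decide) (by decide)) (hfr _ (by decide) (by decide))
    have h3' : s'.reg 3 = v := (hfr _ (by decide) (by decide)).trans h3
    refine (spec_distProg hV hd hP' hL' h3' hv hi hk (h2 k le_rfl)).mono ?_
    rintro s₁ T₁ - ⟨hT₁, row₁, hL₁, h4, h5⟩
    refine ⟨by rw [Nat.succ_mul]; omega, row₁, hL₁, fun j hj => ?_, fun j hj => ?_⟩
    · rcases Nat.lt_succ_iff_lt_or_eq.1 hj with hj | rfl
      · rw [h5 j hj.ne, h1 j hj]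
      · exact h4
    · rw [h5 j (by omega), h2 j (by omega)]
  · rintro s' T' ⟨hT, row', hL', h1, -⟩ _
    exact ⟨by omega, row', hL', h1⟩

/-- The recorded neighbour is already nearest among the points of `S` other than `v`, so a single
comparison with the newest point `v` restores optimality over `S`. -/
theorem spec_relaxProg (hV : 20 ≤ V) {S : Finset ℕ} (hP : Params n d s)
    (hL : Layout n d x inn par e row s.mem) (h3 : s.reg 3 = v) (hvS : v ∈ S)
    (hrow : ∀ a ∈ S, ∀ j < n, row a j = prefixDist x a j d) {j : ℕ} (h6 : s.reg 6 = j) (hj : j < n)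
    (hpar : par j ∈ S)
    (hmin : ∀ a ∈ S, a ≠ v → prefixDist x (par j) j d ≤ prefixDist x a j d) :
    Spec ω V relaxProg s T fun s' T' => T' ≤ T + 2 ∧ ∃ par',
      Layout n d x inn par' e row s'.mem ∧ (∀ i, i ≠ j → par' i = par i) ∧ par' j ∈ S ∧
        ∀ a ∈ S, prefixDist x (par' j) j d ≤ prefixDist x a j d := by
  have e1 := eval_load_parE (a := .reg 6) hP hL h6 hj
  have e2 := eval_load_rowE (a := .load (parE (.reg 6))) (b := .reg 6) hP hL e1 h6 hj
  have e3 := eval_load_rowE (a := .reg 3) (b := .reg 6) hP hL h3 h6 hj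
  refine Spec.cond hV (by decide) (fun h => ?_) (fun h => ?_)
  · rw [Expr.eval, e2, e3, hrow _ hpar j hj, hrow _ hvS j hj] at h
    refine Spec.store hV (by decide) (by decide) (fun hb => hb.1 3)
      ⟨le_rfl, Function.update par j v, ?_, fun i hi => Function.update_of_ne hi _ _, by simpa,
        fun a ha => ?_⟩
    · rw [eval_parE hP (a := .reg 6) h6, Expr.eval, h3]
      exact hL.set_par hj _
    · rw [Function.update_self]
      by_cases hav : a = v
      · rw [hav]
      · have := hmin a ha hav
        omega
  · rw [Expr.eval, e2, e3, hrow _ hpar j hj, hrow _ hvS j hj] at h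
    refine Spec.skip ⟨le_rfl, par, hL, fun _ _ => rfl, hpar, fun a ha => ?_⟩
    by_cases hav : a = v
    · rw [hav]; omega
    · exact hmin a ha hav

end Verification

end HammingMST

namespace HammingMST

open RAM

section Verification

variable {ω : ℕ → Bool} {V n d : ℕ} {x : ℕ → ℕ → ℕ} {inn par e : ℕ → ℕ} {row : ℕ → ℕ → ℕ}
  {s : State} {T v w : ℕ}

/-- The marks of the points of `S`. -/
def marks (S : Finset ℕ) (j : ℕ) : ℕ := if j ∈ S then 1 else 0

/-- One pass both relaxes the outside points and finds the nearest. Register 8 starts at `d + 1`,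
above every distance, and in the invariant this value says that no outside point has been met yet.
-/
theorem spec_selectProg (hV : 20 ≤ V) (hd : 2 * d + 1 ≤ V) {S : Finset ℕ}
    (hP : Params n d s) (hL : Layout n d x (marks S) par e row s.mem) (h3 : s.reg 3 = v)
    (hvS : v ∈ S) (hrow : ∀ a ∈ S, ∀ j < n, row a j = prefixDist x a j d)
    (hpar : ∀ j < n, par j ∈ S)
    (hmin : ∀ j < n, j ∉ S → ∀ a ∈ S, a ≠ v → prefixDist x (par j) j d ≤ prefixDist x a j d)
    (hout : ∃ j < n, j ∉ S) :
    Spec ω V selectProg s T fun s' T' => T' ≤ T + 9 * n + 3 ∧ ∃ par',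
      Layout n d x (marks S) par' e row s'.mem ∧ (∀ j < n, par' j ∈ S) ∧
        (∀ j < n, j ∉ S → ∀ a ∈ S, prefixDist x (par' j) j d ≤ prefixDist x a j d) ∧
        s'.reg 7 < n ∧ s'.reg 7 ∉ S ∧ ∀ j < n, j ∉ S →
          prefixDist x (par' (s'.reg 7)) (s'.reg 7) d ≤ prefixDist x (par' j) j d := by
  refine Spec.seq (Spec.assign hV (by decide) (by decide)
    (fun _ => by simp only [Expr.eval, hP.r1]; omega) ?_)
  have hP0 : Params n d
      { s with reg := Function.update s.reg 8 ((Expr.add (.reg 1) (.lit 1)).eval s) } :=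
    hP.congr rfl rfl rfl
  refine Spec.forLoop hV n (fun k s' T' => T' ≤ T + 9 * k + 2 ∧ ∃ par',
      Layout n d x (marks S) par' e row s'.mem ∧ (∀ j < n, par' j ∈ S) ∧
        (∀ j < k, j ∉ S → ∀ a ∈ S, prefixDist x (par' j) j d ≤ prefixDist x a j d) ∧
        (∀ j, k ≤ j → par' j = par j) ∧
        ((s'.reg 8 = d + 1 ∧ ∀ j < k, j ∈ S) ∨ (s'.reg 7 < k ∧ s'.reg 7 ∉ S ∧
          s'.reg 8 = prefixDist x (par' (s'.reg 7)) (s'.reg 7) d ∧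
          ∀ j < k, j ∉ S → s'.reg 8 ≤ prefixDist x (par' j) j d)))
    (by norm_num) (by norm_num) (by norm_num) (by decide)
    (by decide) hP0.r0 (fun _ _ _ _ h => h) ?_ ?_ ?_
  · refine ⟨by omega, par, hL, hpar, by simp, fun _ _ => rfl, Or.inl ⟨?_, by simp⟩⟩
    simp [Expr.eval, hP.r1]
  · rintro k s' T' hk ⟨hT, par', hL', hpar', hmin', hpe, hbest⟩ hi hfr
    have hP' : Params n d s' := hP0.congr (hfr _ (by decide) (by decide))
      (hfr _ (by decide) (by decide)) (hfr _ (by decide) (by decide))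
    have h3' : s'.reg 3 = v := (hfr _ (by decide) (by decide)).trans h3
    have e1 : (Expr.load (innE (.reg 6))).eval s' = marks S k := by
      simp only [Expr.eval, hP'.r2, hi]
      exact hL'.inn_eq k hk
    refine Spec.cond hV (by decide) (fun h => ?_) (fun h => ?_)
    · have hkS : k ∈ S := by
        by_contra hkS
        exact h (e1.trans (if_neg hkS))
      refine Spec.skip ⟨by omega, par', hL', hpar', ?_, fun j hj => hpe j (by omega), ?_⟩
      · intro j hj hjS
        rcases Nat.lt_succ_iff_lt_or_eq.1 hj with hj | rfl
        · exact hmin' j hj hjS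
        · exact absurd hkS hjS
      · rcases hbest with ⟨h8, hall⟩ | ⟨h7, h7S, h8, hall⟩
        · refine Or.inl ⟨h8, fun j hj => ?_⟩
          rcases Nat.lt_succ_iff_lt_or_eq.1 hj with hj | rfl
          · exact hall j hj
          · exact hkS
        · refine Or.inr ⟨by omega, h7S, h8, fun j hj hjS => ?_⟩
          rcases Nat.lt_succ_iff_lt_or_eq.1 hj with hj | rfl
          · exact hall j hj hjS
          · exact absurd hkS hjS
    · have hkS : k ∉ S := by
        intro hkS
        rw [e1, marks, if_pos hkS] at h
        exact one_ne_zero h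
      refine Spec.seq ((spec_relaxProg (j := k) hV hP' hL' h3' hvS hrow hi hk (hpar' k hk) ?_).mono
        ?_)
      · rw [hpe k le_rfl]
        exact hmin k hk hkS
      rintro s₁ T₁ hfr₁ ⟨hT₁, par₁, hL₁, hpe₁, hpark, hmink⟩
      have hP₁ : Params n d s₁ := hP'.congr (hfr₁ _ (by decide)) (hfr₁ _ (by decide))
        (hfr₁ _ (by decide))
      have h6₁ : s₁.reg 6 = k := (hfr₁ _ (by decide)).trans hi
      have h7₁ : s₁.reg 7 = s'.reg 7 := hfr₁ _ (by decide)
      have h8₁ : s₁.reg 8 = s'.reg 8 := hfr₁ _ (by decide)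
      have e2 := eval_load_parE (a := .reg 6) hP₁ hL₁ h6₁ hk
      have e3 := eval_load_rowE (a := .load (parE (.reg 6))) (b := .reg 6) hP₁ hL₁ e2 h6₁ hk
      rw [hrow _ hpark k hk] at e3
      have hpar₁ : ∀ j < n, par₁ j ∈ S := fun j hj => by
        by_cases hjk : j = k
        · rw [hjk]; exact hpark
        · rw [hpe₁ j hjk]; exact hpar' j hj
      have hmin₁ : ∀ j < k + 1, j ∉ S → ∀ a ∈ S,
          prefixDist x (par₁ j) j d ≤ prefixDist x a j d := fun j hj hjS => by
        rcases Nat.lt_succ_iff_lt_or_eq.1 hj with hj | rfl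
        · rw [hpe₁ j hj.ne]; exact hmin' j hj hjS
        · exact hmink
      have hpe₂ : ∀ j, k + 1 ≤ j → par₁ j = par j := fun j hj => by
        -- Neighbours not yet visited are untouched, so the hypothesis `hmin` still applies to them
        -- in later rounds.
        rw [hpe₁ j (by omega), hpe j (by omega)]
      refine Spec.seq (Spec.assign hV (by decide) (by decide) (fun hb => hb.2 _) ?_)
      rw [e3]
      -- A distance is at most `d`, so the initial value `d + 1` always loses the comparison below.
      have hle := prefixDist_le x (par₁ k) k d
      refine Spec.cond hV (by decide) (fun h => ?_) (fun h => ?_)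
      · refine Spec.seq (Spec.assign hV (by decide) (by decide) (fun hb => hb.1 6) ?_)
        refine Spec.assign hV (by decide) (by decide) (fun hb => hb.1 11) ?_
        refine ⟨by omega, par₁, hL₁, hpar₁, hmin₁, hpe₂, Or.inr ?_⟩
        simp only [Expr.eval, ne_eq, Function.update_self, Function.update_of_ne, h8₁,
          Nat.reduceEqDiff, not_false_eq_true, Nat.sub_eq_zero_iff_le, not_le] at h
        simp only [Expr.eval, ne_eq, Function.update_self, Function.update_of_ne, h6₁,
          Nat.reduceEqDiff, not_false_eq_true]
        refine ⟨by omega, hkS, trivial, fun j hj hjS => ?_⟩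
        rcases Nat.lt_succ_iff_lt_or_eq.1 hj with hj | rfl
        · rw [hpe₁ j hj.ne]
          rcases hbest with ⟨-, hall⟩ | ⟨-, -, -, hall⟩
          · exact absurd (hall j hj) hjS
          · exact h.le.trans (hall j hj hjS)
        · exact le_rfl
      · simp only [Expr.eval, ne_eq, Function.update_self, Function.update_of_ne, h8₁,
          Nat.reduceEqDiff, not_false_eq_true, Nat.sub_eq_zero_iff_le] at h
        refine Spec.skip ⟨by omega, par₁, hL₁, hpar₁, hmin₁, hpe₂, Or.inr ?_⟩
        simp only [ne_eq, not_false_eq_true, Function.update_of_ne,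
          Nat.reduceEqDiff, h7₁, h8₁]
        rcases hbest with ⟨h8, -⟩ | ⟨h7, h7S, h8, hall⟩
        · omega
        · refine ⟨by omega, h7S, by rw [hpe₁ _ h7.ne]; exact h8, fun j hj hjS => ?_⟩
          rcases Nat.lt_succ_iff_lt_or_eq.1 hj with hj | rfl
          · rw [hpe₁ j hj.ne]; exact hall j hj hjS
          · exact h
  · rintro s' T' ⟨hT, par', hL', hpar', hmin', -, hbest⟩ _
    refine ⟨by omega, par', hL', hpar', hmin', ?_⟩
    obtain ⟨j, hj, hjS⟩ := hout
    rcases hbest with ⟨-, hall⟩ | ⟨h7, h7S, h8, hall⟩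
    · exact absurd (hall j hj) hjS
    · exact ⟨h7, h7S, fun j hj hjS => h8 ▸ hall j hj hjS⟩

theorem spec_attachProg (hV : 20 ≤ V) (hP : Params n d s)
    (hL : Layout n d x inn par e row s.mem) (h7 : s.reg 7 = v) (hv : v < n) {k : ℕ}
    (h9 : s.reg 9 = k) (hk : k < n) :
    Spec ω V attachProg s T fun s' T' => T' ≤ T + 5 ∧ s'.reg 3 = v ∧ s'.reg 4 = par v ∧
      Layout n d x (Function.update inn v 1) par
        (Function.update (Function.update e (2 * k) v) (2 * k + 1) (par v)) row s'.mem := by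
  refine Spec.seq (Spec.assign hV (by decide) (by decide) (fun hb => hb.1 7) ?_)
  refine Spec.seq (Spec.assign hV (by decide) (by decide) (fun hb => hb.2 _) ?_)
  refine Spec.seq (Spec.store hV (by decide) (by decide) (fun _ => by simp [Expr.eval]; omega) ?_)
  refine Spec.seq (Spec.store hV (by decide) (by decide) (fun hb => hb.1 3) ?_)
  refine Spec.store hV (by decide) (by decide) (fun hb => hb.1 4) ?_
  simp only [Expr.eval, ne_eq, not_false_eq_true, Function.update_of_ne,
    Nat.reduceEqDiff, Function.update_self, hP.r0, hP.r2, h7, h9,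
    hL.par_eq v hv, true_and]
  refine ⟨by omega, ?_⟩
  exact ((hL.set_inn hv 1).set_e (by omega) v).set_e (by omega) (par v)

/-- Since `w ≠ v`, the source row is not overwritten during the copying. -/
theorem spec_copyProg (hV : 20 ≤ V) (hP : Params n d s)
    (hL : Layout n d x inn par e row s.mem) (h3 : s.reg 3 = v) (h4 : s.reg 4 = w) (hvw : w ≠ v) :
    Spec ω V copyProg s T fun s' T' => T' ≤ T + 3 * n + 2 ∧ ∃ row',
      Layout n d x inn par e row' s'.mem ∧ (∀ j < n, row' v j = row w j) ∧
        ∀ a, a ≠ v → row' a = row a := by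
  refine Spec.forLoop hV n (fun k s' T' => T' ≤ T + 3 * k + 1 ∧ ∃ row',
      Layout n d x inn par e row' s'.mem ∧ (∀ j < k, row' v j = row w j) ∧
        ∀ a, a ≠ v → row' a = row a) (by norm_num) (by norm_num) (by norm_num) (by decide)
    (by decide) hP.r0 (fun _ _ _ _ h => h) ⟨by omega, row, hL, by simp, fun _ _ => rfl⟩ ?_ ?_
  · rintro k s' T' hk ⟨hT, row', hL', h1, h2⟩ hi hfr
    have hP' : Params n d s' := hP.congr (hfr _ (by decide) (by decide))
      (hfr _ (by decide) (by decide)) (hfr _ (by decide) (by decide))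
    have h3' : s'.reg 3 = v := (hfr _ (by decide) (by decide)).trans h3
    have h4' : s'.reg 4 = w := (hfr _ (by decide) (by decide)).trans h4
    have e1 := eval_load_rowE (a := .reg 4) (b := .reg 6) hP' hL' h4' hi hk
    refine Spec.store hV (by decide) (by decide) (fun hb => hb.2 _) ⟨by omega,
      Function.update row' v (Function.update (row' v) k (row w k)), ?_, ?_, ?_⟩
    · rw [e1, h2 w hvw, eval_rowE hP' (a := .reg 3) (b := .reg 6) h3' hi]
      exact hL'.set_row v hk _
    · intro j hj
      rcases Nat.lt_succ_iff_lt_or_eq.1 hj with hj | rfl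
      · simp [hj.ne, h1 j hj]
      · simp
    · intro a ha
      rw [Function.update_of_ne ha, h2 a ha]
  · rintro s' T' ⟨hT, row', hL', h1, h2⟩ _
    exact ⟨by omega, row', hL', h1, h2⟩

/-- The row holds the distances from a hybrid point that agrees with `v` in the coordinates below
`c` and with `w` in the others; the correction moves coordinate `c` from `w` to `v`. The identity is
written additively to avoid truncated subtraction. -/
theorem spec_correctProg (hV : 20 ≤ V) (hd : 2 * d + 1 ≤ V) (hP : Params n d s)
    (hL : Layout n d x inn par e row s.mem) (h3 : s.reg 3 = v) (h4 : s.reg 4 = w) (hv : v < n)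
    (hw : w < n) {c : ℕ} (h5 : s.reg 5 = c) (hc : c < d)
    (hrow : ∀ j < n, row v j + prefixDist x w j c = prefixDist x w j d + prefixDist x v j c) :
    Spec ω V correctProg s T fun s' T' => T' ≤ T + 3 * n + 2 ∧ ∃ row',
      Layout n d x inn par e row' s'.mem ∧ (∀ j < n, row' v j + prefixDist x w j (c + 1) =
        prefixDist x w j d + prefixDist x v j (c + 1)) ∧ ∀ a, a ≠ v → row' a = row a := by
  refine Spec.forLoop hV n (fun k s' T' => T' ≤ T + 3 * k + 1 ∧ ∃ row',
      Layout n d x inn par e row' s'.mem ∧ (∀ j < k, row' v j + prefixDist x w j (c + 1) =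
        prefixDist x w j d + prefixDist x v j (c + 1)) ∧ (∀ j, k ≤ j → row' v j = row v j) ∧
        ∀ a, a ≠ v → row' a = row a) (by norm_num) (by norm_num) (by norm_num) (by decide)
    (by decide) hP.r0 (fun _ _ _ _ h => h)
    ⟨by omega, row, hL, by simp, fun _ _ => rfl, fun _ _ => rfl⟩ ?_ ?_
  · rintro k s' T' hk ⟨hT, row', hL', h1, h1', h2⟩ hi hfr
    have hP' : Params n d s' := hP.congr (hfr _ (by decide) (by decide))
      (hfr _ (by decide) (by decide)) (hfr _ (by decide) (by decide))
    have h3' : s'.reg 3 = v := (hfr _ (by decide) (by decide)).trans h3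
    have h4' : s'.reg 4 = w := (hfr _ (by decide) (by decide)).trans h4
    have h5' : s'.reg 5 = c := (hfr _ (by decide) (by decide)).trans h5
    have e1 := eval_load_rowE (a := .reg 3) (b := .reg 6) hP' hL' h3' hi hk
    have e2 := eval_ptE (a := .reg 3) (b := .reg 5) hP' hL' h3' h5' hv hc
    have e3 := eval_ptE (a := .reg 4) (b := .reg 5) hP' hL' h4' h5' hw hc
    have e4 := eval_ptE (a := .reg 6) (b := .reg 5) hP' hL' hi h5' hk hc
    have h6 := hrow k hk
    -- This makes the machine's truncated subtraction exact, given that the program adds before it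
    -- subtracts.
    have h7 := prefixDist_mono x w k (show c + 1 ≤ d from hc)
    have h8 := prefixDist_succ x w k c
    have h9 := prefixDist_succ x v k c
    have e5 : (Expr.sub (.add (.load (rowE (.reg 3) (.reg 6)))
        (neqE (ptE (.reg 3) (.reg 5)) (ptE (.reg 6) (.reg 5))))
        (neqE (ptE (.reg 4) (.reg 5)) (ptE (.reg 6) (.reg 5)))).eval s' =
        prefixDist x w k d + prefixDist x v k (c + 1) - prefixDist x w k (c + 1) := by
      rw [Expr.eval, Expr.eval, eval_neqE, eval_neqE, e1, e2, e3, e4, h1' k le_rfl]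
      omega
    have h10 := prefixDist_le x w k d
    have h11 := prefixDist_le x v k (c + 1)
    refine Spec.store hV (by decide) (by decide) (fun _ => by omega) ⟨by omega,
      Function.update row' v (Function.update (row' v) k
        (prefixDist x w k d + prefixDist x v k (c + 1) - prefixDist x w k (c + 1))), ?_, ?_, ?_, ?_⟩
    · rw [e5, eval_rowE hP' (a := .reg 3) (b := .reg 6) h3' hi]
      exact hL'.set_row v hk _
    · intro j hj
      rcases Nat.lt_succ_iff_lt_or_eq.1 hj with hj | rfl
      · simp [hj.ne, h1 j hj]
      · simp only [Function.update_self]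
        omega
    · intro j hj
      rw [Function.update_self, Function.update_of_ne (by omega), h1' j (by omega)]
    · intro a ha
      rw [Function.update_of_ne ha, h2 a ha]
  · rintro s' T' ⟨hT, row', hL', h1, -, h2⟩ _
    exact ⟨by omega, row', hL', h1, h2⟩

/-- In a coordinate where `v` and `w` agree the hybrid point does not change, so nothing is done.
Only the differing coordinates cost `3 * n + 2`, which yields the term proportional to the edge
length. -/
theorem spec_updateProg (hV : 20 ≤ V) (hd : 2 * d + 1 ≤ V) (hP : Params n d s)
    (hL : Layout n d x inn par e row s.mem) (h3 : s.reg 3 = v) (h4 : s.reg 4 = w) (hv : v < n)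
    (hw : w < n) (hrow : ∀ j < n, row v j = prefixDist x w j d) :
    Spec ω V updateProg s T fun s' T' =>
      T' ≤ T + 4 * d + (3 * n + 2) * prefixDist x v w d + 2 ∧ ∃ row',
      Layout n d x inn par e row' s'.mem ∧ (∀ j < n, row' v j = prefixDist x v j d) ∧
        ∀ a, a ≠ v → row' a = row a := by
  refine Spec.forLoop hV d (fun k s' T' =>
      T' ≤ T + 4 * k + (3 * n + 2) * prefixDist x v w k + 1 ∧ ∃ row',
      Layout n d x inn par e row' s'.mem ∧ (∀ j < n, row' v j + prefixDist x w j k =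
        prefixDist x w j d + prefixDist x v j k) ∧
        ∀ a, a ≠ v → row' a = row a) (by norm_num) (by norm_num) (by norm_num) (by decide)
    (by decide) hP.r1 (fun _ _ _ _ h => h)
    ⟨by simp, row, hL, by simpa using hrow, fun _ _ => rfl⟩ ?_ ?_
  · rintro k s' T' hk ⟨hT, row', hL', h1, h2⟩ hi hfr
    have hP' : Params n d s' := hP.congr (hfr _ (by decide) (by decide))
      (hfr _ (by decide) (by decide)) (hfr _ (by decide) (by decide))
    have h3' : s'.reg 3 = v := (hfr _ (by decide) (by decide)).trans h3
    have h4' : s'.reg 4 = w := (hfr _ (by decide) (by decide)).trans h4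
    have e2 := eval_ptE (a := .reg 3) (b := .reg 5) hP' hL' h3' hi hv hk
    have e3 := eval_ptE (a := .reg 4) (b := .reg 5) hP' hL' h4' hi hw hk
    refine Spec.cond hV (by decide) (fun h => ?_) (fun h => ?_)
    · rw [Ne, eval_neE_eq_zero, e2, e3] at h
      refine (spec_correctProg hV hd hP' hL' h3' h4' hv hw hi hk h1).mono ?_
      rintro s₁ T₁ - ⟨hT₁, row₁, hL₁, h5, h6⟩
      refine ⟨?_, row₁, hL₁, h5, fun a ha => by rw [h6 a ha, h2 a ha]⟩
      rw [prefixDist_succ, if_neg h, mul_add (3 * n + 2)]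
      omega
    · rw [eval_neE_eq_zero, e2, e3] at h
      refine Spec.skip ⟨?_, row', hL', fun j hj => ?_, h2⟩
      · rw [prefixDist_succ, if_pos h, add_zero]
        omega
      · have := h1 j hj
        rw [prefixDist_succ, prefixDist_succ, h]
        omega
  · rintro s' T' ⟨hT, row', hL', h1, h2⟩ _
    exact ⟨by omega, row', hL', fun j hj => by have := h1 j hj; omega, h2⟩

end Verification

end HammingMST

/-! ### From memory contents to points and graphs -/

namespace HammingMST

open RAM

variable {q n d : ℕ}

/-- The coordinates of the points as natural numbers. -/
def coords (p : Fin n → Fin d → Fin q) (v c : ℕ) : ℕ :=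
  if h : v < n ∧ c < d then p ⟨v, h.1⟩ ⟨c, h.2⟩ else 0

theorem hammingDist_eq_prefixDist (p : Fin n → Fin d → Fin q) (a b : Fin n) :
    hammingDist (p a) (p b) = prefixDist (coords p) a b d := by
  rw [prefixDist, Finset.sum_range, hammingDist, Finset.card_filter]
  refine Finset.sum_congr rfl fun i _ => ?_
  simp [coords, Fin.ext_iff]

/-- The graph with the edges listed in `e 0, …, e (2 * k - 1)`. -/
def listGraph (n k : ℕ) (e : ℕ → ℕ) : SimpleGraph (Fin n) :=
  SimpleGraph.fromRel fun i j => ∃ l < k, e (2 * l) = i ∧ e (2 * l + 1) = j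

theorem listGraph_zero (e : ℕ → ℕ) : listGraph n 0 e = ⊥ := by
  ext a b
  simp [listGraph]

theorem listGraph_congr {k : ℕ} {e e' : ℕ → ℕ} (h : ∀ i < 2 * k, e i = e' i) :
    listGraph n k e = listGraph n k e' := by
  have key : ∀ a b : Fin n, (∃ l < k, e (2 * l) = a ∧ e (2 * l + 1) = b) ↔
      ∃ l < k, e' (2 * l) = a ∧ e' (2 * l + 1) = b := fun a b =>
    exists_congr fun l => and_congr_right fun hl => by
      rw [h _ (by omega), h _ (by omega)]
  ext a b
  simp only [listGraph, SimpleGraph.fromRel_adj, key]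

theorem listGraph_succ (k : ℕ) (e : ℕ → ℕ) (v w : Fin n) :
    listGraph n (k + 1) (Function.update (Function.update e (2 * k) v) (2 * k + 1) w) =
      listGraph n k e ⊔ SimpleGraph.edge v w := by
  have key : ∀ a b : Fin n, (∃ l < k + 1,
      Function.update (Function.update e (2 * k) v) (2 * k + 1) (w : ℕ) (2 * l) = a ∧
      Function.update (Function.update e (2 * k) v) (2 * k + 1) (w : ℕ) (2 * l + 1) = b) ↔
      (∃ l < k, e (2 * l) = a ∧ e (2 * l + 1) = b) ∨ (v = a ∧ w = b) := by
    intro a b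
    rw [Nat.exists_lt_succ_right]
    refine or_congr (exists_congr fun l => and_congr_right fun hl => ?_) ?_
    · rw [Function.update_of_ne (by omega), Function.update_of_ne (by omega),
        Function.update_of_ne (by omega), Function.update_of_ne (by omega)]
    · rw [Function.update_of_ne (by omega), Function.update_self, Function.update_self,
        Fin.ext_iff, Fin.ext_iff]
  ext a b
  simp only [listGraph, SimpleGraph.fromRel_adj, key, SimpleGraph.sup_adj, SimpleGraph.edge_adj]
  grind

/-- All blocks after the coordinates start as zeros, which here encode an empty tree and blank
distances. -/
theorem layout_inputState (p : Fin n → Fin d → Fin q) :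
    Layout n d (coords p) (marks ∅) (fun _ => 0) (fun _ => 0) (fun _ _ => 0) (inputState p).mem where
  x_eq v hv c hc := by
    have h1 : (v * d + c) / d = v := by
      rw [Nat.mul_comm, Nat.mul_add_div (by omega), Nat.div_eq_of_lt hc, add_zero]
    have h2 : (v * d + c) % d = c := by
      rw [Nat.mul_comm, Nat.mul_add_mod, Nat.mod_eq_of_lt hc]
    simp only [inputState, coords, dif_pos (mul_add_lt_mul hv hc), dif_pos (And.intro hv hc), h1, h2]
  inn_eq j hj := dif_neg (by omega)
  par_eq j hj := dif_neg (by omega)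
  e_eq j hj := dif_neg (by omega)
  row_eq v j hj := dif_neg (by omega)

theorem update_marks (S : Finset ℕ) (v : ℕ) :
    Function.update (marks S) v 1 = marks (insert v S) := by
  ext j
  by_cases h : j = v <;> simp [marks, h]

/-! ### The rounds of Prim's algorithm -/

/-- After `k` rounds of Prim's algorithm, the memory `m` holds a tree on `k + 1` points, of which
`v` is the last one. -/
def PrimInv (p : Fin n → Fin d → Fin q) (k v : ℕ) (m : ℕ → ℕ) (c : ℕ) : Prop :=
  ∃ (S : Finset ℕ) (par e : ℕ → ℕ) (row : ℕ → ℕ → ℕ),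
    Layout n d (coords p) (marks S) par e row m ∧ v ∈ S ∧ S.card = k + 1 ∧ (∀ a ∈ S, a < n) ∧
    (∀ a ∈ S, ∀ j < n, row a j = prefixDist (coords p) a j d) ∧ (∀ j < n, par j ∈ S) ∧
    (∀ j < n, j ∉ S → ∀ a ∈ S, a ≠ v →
      prefixDist (coords p) (par j) j d ≤ prefixDist (coords p) a j d) ∧
    PartialMST p {a | (a : ℕ) ∈ S} k (listGraph n k e) ∧ cost p (listGraph n k e) = c

variable {ω : ℕ → Bool} {V : ℕ} {s : State} {T : ℕ}

/-- An amortized bound: with the potential `(3 * n + 2) * c`, where `c` is the cost of the tree so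
far, the edge-length term of `spec_updateProg` is paid by the growth of the tree. The remainder, `12
* n + 4 * d + 12`, sums the four phases. -/
theorem spec_round (hV : 20 ≤ V) (hd : 2 * d + 1 ≤ V) (p : Fin n → Fin d → Fin q) {k c : ℕ}
    (hk : k + 1 < n) (hP : Params n d s) (h9 : s.reg 9 = k)
    (hI : PrimInv p k (s.reg 3) s.mem c) :
    Spec ω V (.seq selectProg (.seq attachProg (.seq copyProg updateProg))) s T fun s' T' =>
      ∃ c', PrimInv p (k + 1) (s'.reg 3) s'.mem c' ∧
        T' + (3 * n + 2) * c ≤ T + 12 * n + 4 * d + 12 + (3 * n + 2) * c' := by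
  obtain ⟨S, par, e, row, hL, hvS, hcard, hSn, hrow, hpar, hmin, hF, hc⟩ := hI
  have hout : ∃ j < n, j ∉ S := by
    by_contra! h
    have := Finset.card_le_card (fun j hj => h j (Finset.mem_range.1 hj) : Finset.range n ⊆ S)
    rw [Finset.card_range] at this
    omega
  refine Spec.seq ((spec_selectProg hV hd hP hL rfl hvS hrow hpar hmin hout).mono ?_)
  rintro s₁ T₁ hfr₁ ⟨hT₁, par₁, hL₁, hpar₁, hmin₁, hbn, hbS, hbest⟩
  have hP₁ : Params n d s₁ := hP.congr (hfr₁ _ (by decide)) (hfr₁ _ (by decide))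
    (hfr₁ _ (by decide))
  obtain ⟨v, hv⟩ : ∃ v : Fin n, s₁.reg 7 = v := ⟨⟨_, hbn⟩, rfl⟩
  rw [hv] at hbS hbest
  obtain ⟨w, hw⟩ : ∃ w : Fin n, par₁ v = w := ⟨⟨_, hSn _ (hpar₁ v v.2)⟩, rfl⟩
  have hwS : (w : ℕ) ∈ S := hw ▸ hpar₁ v v.2
  refine Spec.seq ((spec_attachProg hV hP₁ hL₁ hv v.2 ((hfr₁ 9 (by decide)).trans h9)
    (by omega)).mono ?_)
  rintro s₂ T₂ hfr₂ ⟨hT₂, h3₂, h4₂, hL₂⟩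
  have hP₂ : Params n d s₂ := hP₁.congr (hfr₂ _ (by decide)) (hfr₂ _ (by decide))
    (hfr₂ _ (by decide))
  rw [hw] at h4₂ hL₂
  rw [update_marks] at hL₂
  have hwv : (w : ℕ) ≠ v := fun h => hbS (h ▸ hwS)
  refine Spec.seq ((spec_copyProg hV hP₂ hL₂ h3₂ h4₂ hwv).mono ?_)
  rintro s₃ T₃ hfr₃ ⟨hT₃, row₃, hL₃, hrow₃, hrow₃'⟩
  have hP₃ : Params n d s₃ := hP₂.congr (hfr₃ _ (by decide)) (hfr₃ _ (by decide))
    (hfr₃ _ (by decide))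
  refine (spec_updateProg hV hd hP₃ hL₃ ((hfr₃ 3 (by decide)).trans h3₂)
    ((hfr₃ 4 (by decide)).trans h4₂) v.2 w.2
    (fun j hj => by rw [hrow₃ j hj, hrow w hwS j hj])).mono ?_
  rintro s₄ T₄ hfr₄ ⟨hT₄, row₄, hL₄, hrow₄, hrow₄'⟩
  have h3₄ : s₄.reg 3 = v := ((hfr₄ 3 (by decide)).trans (hfr₃ 3 (by decide))).trans h3₂
  -- For an edge from `a` in the tree to `b` outside: `v` is no farther from its neighbour than `b`
  -- is from its own, and the neighbour of `b` is no farther from it than `a`.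
  obtain ⟨hF', hc'⟩ := hF.sup_edge (v := v) (w := w) hwS hbS fun a ha b hb => by
    rw [hammingDist_eq_prefixDist, hammingDist_eq_prefixDist, prefixDist_comm, ← hw]
    exact (hbest b b.2 hb).trans (hmin₁ b b.2 hb a ha)
  refine ⟨c + prefixDist (coords p) v w d, ⟨insert (v : ℕ) S, par₁, _, row₄, hL₄, ?_, ?_, ?_, ?_,
    ?_, ?_, ?_, ?_⟩, ?_⟩
  · rw [h3₄]; exact Finset.mem_insert_self _ _
  · rw [Finset.card_insert_of_notMem hbS, hcard]
  · intro a ha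
    rcases Finset.mem_insert.1 ha with rfl | ha
    · exact v.2
    · exact hSn a ha
  · intro a ha j hj
    rcases Finset.mem_insert.1 ha with rfl | ha
    · exact hrow₄ j hj
    · have hav : a ≠ v := fun h => hbS (h ▸ ha)
      rw [hrow₄' a hav, hrow₃' a hav, hrow a ha j hj]
  · exact fun j hj => Finset.mem_insert_of_mem (hpar₁ j hj)
  -- Excluding the new point `v` leaves the old tree, for which the selection phase has made the
  -- neighbours nearest.
  · intro j hj hjS a ha hav
    rw [h3₄] at hav
    exact hmin₁ j hj (fun h => hjS (Finset.mem_insert_of_mem h)) a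
      (Finset.mem_of_mem_insert_of_ne ha hav)
  · rw [listGraph_succ]
    convert hF' using 1
    ext a
    simp [Fin.ext_iff]
  · rw [listGraph_succ, hc', hc, hammingDist_eq_prefixDist]
  · rw [mul_add]
    omega

/-- The potential telescopes to the cost of the final tree, which equals `mstCost p` because that
tree is minimum. -/
theorem spec_rounds (hn : 0 < n) (hV : 20 ≤ V) (hd : 2 * d + 1 ≤ V) (p : Fin n → Fin d → Fin q)
    (hP : Params n d s) (h10 : s.reg 10 = n - 1) (hI : PrimInv p 0 (s.reg 3) s.mem 0) :
    Spec ω V (.forLoop 9 10 (.seq selectProg (.seq attachProg (.seq copyProg updateProg)))) s T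
      fun s' T' => ∃ e, (∀ i < 2 * n, s'.mem (n * d + 2 * n + i) = e i) ∧
        IsMST p (listGraph n (n - 1) e) ∧
        T' ≤ T + n * (12 * n + 4 * d + 14) + (3 * n + 2) * mstCost p + 2 := by
  refine Spec.forLoop hV (n - 1) (fun k s' T' => ∃ c, PrimInv p k (s'.reg 3) s'.mem c ∧
      T' ≤ T + k * (12 * n + 4 * d + 14) + (3 * n + 2) * c + 1) (by norm_num) (by norm_num)
    (by norm_num) (by decide) (by decide) h10 (fun _ _ _ _ h => h) ⟨0, hI, by simp⟩ ?_ ?_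
  · rintro k s' T' hk ⟨c, hc, hT⟩ hi hfr
    have hP' : Params n d s' := hP.congr (hfr _ (by decide) (by decide))
      (hfr _ (by decide) (by decide)) (hfr _ (by decide) (by decide))
    refine (spec_round hV hd p (by omega) hP' hi hc).mono ?_
    rintro s₁ T₁ - ⟨c', hc', hT'⟩
    refine ⟨c', hc', ?_⟩
    rw [Nat.succ_mul]
    omega
  · rintro s' T' ⟨c, ⟨S, par, e, row, hL, -, -, -, -, -, -, hF, rfl⟩, hT⟩ _
    refine ⟨e, hL.e_eq, hF.isMST, ?_⟩
    rw [hF.isMST.mstCost_eq]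
    have : (n - 1) * (12 * n + 4 * d + 14) ≤ n * (12 * n + 4 * d + 14) :=
      Nat.mul_le_mul_right _ (Nat.sub_le _ _)
    omega

theorem spec_mstProg_aux (hn : 0 < n) (hV : n * d + 2 * n + 20 ≤ V) (hd : 2 * d + 1 ≤ V)
    (p : Fin n → Fin d → Fin q) (hP : Params n d s) (h10 : s.reg 10 = n - 1) (h3 : s.reg 3 = 0)
    (hmem : s.mem = (inputState p).mem) :
    Spec ω V (.seq firstRowProg (.seq (.store (innE (.reg 3)) (.lit 1))
      (.seq (.forLoop 9 10 (.seq selectProg (.seq attachProg (.seq copyProg updateProg))))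
        (.assign 0 (edgeE (.lit 0)))))) s 2 fun s' T' => IsMST p (outputGraph n s') ∧
      T' ≤ 40 * (n * (d + n + mstCost p)) := by
  have hV' : 20 ≤ V := by omega
  have hL : Layout n d (coords p) (marks ∅) (fun _ => 0) (fun _ => 0) (fun _ _ => 0) s.mem :=
    hmem ▸ layout_inputState p
  refine Spec.seq ((spec_firstRowProg hV' (by omega) hP hL h3 hn fun _ => rfl).mono ?_)
  rintro s₁ T₁ hfr₁ ⟨hT₁, row₁, hL₁, hrow₁⟩
  have hP₁ : Params n d s₁ := hP.congr (hfr₁ _ (by decide)) (hfr₁ _ (by decide))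
    (hfr₁ _ (by decide))
  have h3₁ : s₁.reg 3 = 0 := (hfr₁ _ (by decide)).trans h3
  have h10₁ : s₁.reg 10 = n - 1 := (hfr₁ _ (by decide)).trans h10
  refine Spec.seq (Spec.store hV' (by decide) (by decide)
    (fun _ => by simp only [Expr.eval]; omega) ?_)
  have hP₂ : ∀ m, Params n d { s₁ with mem := m } := fun _ => hP₁.congr rfl rfl rfl
  refine Spec.seq (Spec.mono (spec_rounds hn hV' hd p ?_ ?_ ?_) ?_)
  · exact hP₂ _
  · exact h10₁
  -- The tree starts as the point 0, which is also the last point attached, so the neighbour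
  -- condition is vacuous and the zeroed neighbours are valid.
  · refine ⟨{0}, fun _ => 0, fun _ => 0, row₁, ?_, by simp [h3₁], by simp, by simpa using hn,
      by simpa using hrow₁,
      fun _ _ => by simp, ?_, ?_, ?_⟩
    · simp only [Expr.eval, hP₁.r2, h3₁]
      have := hL₁.set_inn hn 1
      rwa [update_marks] at this
    · intro j _ _ a ha hav
      rw [Finset.mem_singleton] at ha
      exact absurd (ha.trans h3₁.symm) hav
    · rw [listGraph_zero]
      exact PartialMST.bot hn _
    · rw [listGraph_zero]
      simp [cost]
  · rintro s₃ T₃ hfr₃ ⟨e, he, hMST, hT₃⟩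
    have hP₃ : Params n d s₃ := (hP₂ _).congr (hfr₃ _ (by decide)) (hfr₃ _ (by decide))
      (hfr₃ _ (by decide))
    have h0 : (edgeE (.lit 0)).eval s₃ = n * d + 2 * n := by
      simp only [Expr.eval, hP₃.r0, hP₃.r2, add_zero]
    refine Spec.assign hV' (by decide) (by decide) (fun _ => by omega) ⟨?_, ?_⟩
    · rw [h0]
      have : outputGraph n { s₃ with reg := Function.update s₃.reg 0 (n * d + 2 * n) } =
          listGraph n (n - 1) fun i => s₃.mem (n * d + 2 * n + i) := by
        simp [outputGraph, listGraph, add_assoc]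
      rw [this, listGraph_congr (e' := e) fun i hi => he i (by omega)]
      exact hMST
    · nlinarith [Nat.mul_le_mul hn hn, Nat.mul_le_mul_right n hn, Nat.mul_le_mul_right d hn,
        Nat.mul_le_mul_right (mstCost p) hn]

theorem spec_mstProg (hn : 0 < n) (hV : n * d + 2 * n + 20 ≤ V) (hd : 2 * d + 1 ≤ V)
    (p : Fin n → Fin d → Fin q) :
    Spec ω V mstProg (inputState p) 0 fun s' T' => IsMST p (outputGraph n s') ∧
      T' ≤ 40 * (n * (d + n + mstCost p)) := by
  have hV' : 20 ≤ V := by omega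
  have h2 : (Expr.mul (.reg 0) (.reg 1)).eval (inputState p) = n * d := rfl
  refine Spec.seq (Spec.assign hV' (by decide) (by decide) (fun _ => by omega) ?_)
  rw [h2]
  refine Spec.seq (Spec.assign hV' (by decide) (by decide)
    (fun _ => by simp [Expr.eval, inputState]; omega) ?_)
  exact spec_mstProg_aux hn hV hd p ⟨rfl, rfl, rfl⟩ rfl rfl rfl

/-! ### From instruction counts to the logarithmic cost -/

theorem bounded_inputState (p : Fin n → Fin d → Fin q) (hn : n ≤ V) (hd : d ≤ V) (hq : q ≤ V) :
    Bounded V (inputState p) := by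
  refine ⟨fun i => ?_, fun a => ?_⟩
  · simp only [inputState]
    split_ifs <;> omega
  · simp only [inputState]
    split_ifs
    · exact (Fin.is_lt _).le.trans hq
    · exact Nat.zero_le _

theorem bitLen_mul_le (a b : ℕ) : bitLen (a * b) ≤ bitLen a + bitLen b := by
  have ha : a < 2 ^ bitLen a := Nat.lt_pow_succ_log_self (by norm_num) a
  have hb : b < 2 ^ bitLen b := Nat.lt_pow_succ_log_self (by norm_num) b
  have h : a * b < 2 ^ (bitLen a + bitLen b) := by
    rw [pow_add]
    exact Nat.mul_lt_mul'' ha hb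
  have := one_le_bitLen a
  exact Nat.succ_le_of_lt (Nat.log_lt_of_lt_pow' (by omega) h)

theorem mstProg_runs (hn : 0 < n) (hd : 0 < d) (p : Fin n → Fin d → Fin q) (ω : ℕ → Bool) :
    ∃ s t, Runs ω mstProg (inputState p) s t ∧ IsMST p (outputGraph n s) ∧
      t ≤ softBound (2400000 * bitLen (q + 30)) 1 (n * (d + n + mstCost p)) := by
  set f := n * (d + n + mstCost p) with hf
  have h1 : n * d ≤ f := Nat.mul_le_mul_left _ (by omega)
  have h2 : n ≤ f := Nat.le_mul_of_pos_right _ (by omega)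
  have h3 : d ≤ n * d := Nat.le_mul_of_pos_left _ hn
  have hV : (q + 30) * f = q * f + 30 * f := add_mul _ _ _
  have hq : q ≤ q * f := Nat.le_mul_of_pos_right _ (by omega)
  -- The bound `(q + 30) * f` dominates the input and everything the program stores, while its
  -- length is at most that of `f` plus a constant depending on `q`. The final constant is 40 ·
  -- 30000 · 2.
  obtain ⟨s, t, T, hr, ht, -, -, hmst, hT⟩ := spec_mstProg (ω := ω) (V := (q + 30) * f) hn
    (by omega) (by omega) p (bounded_inputState p (by omega) (by omega) (by omega))
  refine ⟨s, t, hr, hmst, ?_⟩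
  have h4 := bitLen_mul_le (q + 30) f
  have h5 := one_le_bitLen (q + 30)
  have h6 := one_le_bitLen f
  have h7 : bitLen (q + 30) + bitLen f ≤ 2 * (bitLen (q + 30) * bitLen f) := by nlinarith
  calc t ≤ T * unitCost ((q + 30) * f) := by omega
    _ ≤ 40 * f * (30000 * (2 * (bitLen (q + 30) * bitLen f))) :=
      Nat.mul_le_mul hT (Nat.mul_le_mul_left _ (h4.trans h7))
    _ = softBound (2400000 * bitLen (q + 30)) 1 f := by
      rw [softBound, pow_one, ← bitLen]
      ring

end HammingMST

instance : MeasureTheory.IsProbabilityMeasure RAM.coinMeasure := by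
  unfold RAM.coinMeasure
  infer_instance

theorem mainTheorem6 (q : ℕ) (α : ℝ) (hα : 1 ≤ α) :
    ∃ (P : RAM.Prog) (C k : ℕ), ∀ (n d : ℕ), 0 < n → 0 < d →
      ∀ p : Fin n → Fin d → Fin q,
        (∀ ω : ℕ → Bool, ∃ (s : RAM.State) (t : ℕ),
          RAM.Runs ω P (HammingMST.inputState p) s t ∧
            HammingMST.IsMST p (HammingMST.outputGraph n s)) ∧
        1 - 1 / ((n * d : ℕ) : ℝ) ^ α ≤
          RAM.coinMeasure.real {ω : ℕ → Bool | ∃ (s : RAM.State) (t : ℕ),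
            RAM.Runs ω P (HammingMST.inputState p) s t ∧
              t ≤ softBound C k (n * (d + n + HammingMST.mstCost p))} := by
  refine ⟨HammingMST.mstProg, 2400000 * RAM.bitLen (q + 30), 1, fun n d hn hd p => ⟨fun ω => ?_, ?_⟩⟩
  · obtain ⟨s, t, h1, h2, -⟩ := HammingMST.mstProg_runs hn hd p ω
    exact ⟨s, t, h1, h2⟩
  · have huniv : {ω : ℕ → Bool | ∃ (s : RAM.State) (t : ℕ),
        RAM.Runs ω HammingMST.mstProg (HammingMST.inputState p) s t ∧
          t ≤ softBound (2400000 * RAM.bitLen (q + 30)) 1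
            (n * (d + n + HammingMST.mstCost p))} = Set.univ := by
      refine Set.eq_univ_of_forall fun ω => ?_
      obtain ⟨s, t, h1, -, h3⟩ := HammingMST.mstProg_runs hn hd p ω
      exact ⟨s, t, h1, h3⟩
    rw [huniv, MeasureTheory.probReal_univ]
    exact sub_le_self _ (by positivity)
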